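/- Let $\mathbb{H}=\{\tau\in\mathbb{C} : \operatorname{Im}\tau>0\}$, let $E_6(\tau)=1-504\sum_{n\ge 1}\sigma_5(n)e^{2\pi i n\tau}$, where $\sigma_5(n)=\sum_{m\mid n}m^5$, be the normalized Eisenstein series of weight $6$ on $\mathbb{H}$, and let $$F=\{\tau\in\mathbb{H} : 0\le \operatorname{Re}\tau\le 1,\ |\tau|\ge 1,\ |\tau-1|\ge 1\}.$$ A critical point of $E_6$ is a point $\tau\in\mathbb{H}$ with $E_6'(\tau)=0$. Let $\gamma=\begin{pmatrix}a&b\\c&d\end{pmatrix}\in SL(2,\mathbb{Z})$, write $\gamma(S)=\{\frac{a\tau+b}{c\tau+d} : \tau\in S\}$ for $S\subseteq\mathbb{H}$, let $\partial$ denote the topological boundary in $\mathbb{H}$, and put $\frac{-d}{c}=\infty$ if $c=0$. Then $\partial\gamma(F)=\gamma(\partial F)$, and: 1. If $\frac{-d}{c}\in(0,1)\cup\{\infty\}$, then $E_6$ has no critical point in $\gamma(F)$. 2. If $\frac{-d}{c}\in(-\infty,0]\cup[1,+\infty)$, then $E_6$ has exactly one critical point in $\gamma(F)$; this critical point lies on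 $\partial\gamma(F)$ if and only if $\frac{-d}{c}\in\{0,1\}$. -/

import Mathlib

open UpperHalfPlane
open scoped MatrixGroups

/-- The closed fundamental domain of `SL(2, ℤ)`
`{τ ∈ ℍ | 0 ≤ Re τ ≤ 1, |τ| ≥ 1, |τ - 1| ≥ 1}`. -/
def basicDomain : Set ℍ :=
  {τ : ℍ | 0 ≤ τ.re ∧ τ.re ≤ 1 ∧ 1 ≤ ‖(τ : ℂ)‖ ∧ 1 ≤ ‖(τ : ℂ) - 1‖}

/-- The image `γ(S)` of a set `S ⊆ ℍ` under the Möbius transformation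
`τ ↦ (a τ + b) / (c τ + d)`. -/
def moebiusImage (γ : SL(2, ℤ)) (S : Set ℍ) : Set ℍ :=
  (fun τ : ℍ => γ • τ) '' S

/-- `τ` is a critical point of `E₆`: the complex derivative of `E₆` vanishes at `τ`
(`ofComplex` is the inverse of the inclusion `ℍ → ℂ` on the open upper half plane, so that
`E₆ ∘ ofComplex` is the normalised Eisenstein series of weight 6 as a function of a complex
variable near `τ`). -/
def IsCriticalPointE6 (τ : ℍ) : Prop :=
  HasDerivAt ((ModularForm.E₆ : ℍ → ℂ) ∘ ofComplex) 0 (τ : ℂ)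

/-!
For `γ = (a b; c d)` in `SL(2, ℤ)`, differentiating `E₆(γz) = (cz + d)⁶ E₆(z)` shows that `γz` is a
critical point of `E₆` if and only if `c h(z) + d = 0`, where `h(z) = z + 6 E₆(z) / E₆'(z)`
(`isCriticalPointE6_smul_iff`); here `E₆'` has no zero with `Im z ≥ √3 / 2`. The theorem thus
describes where `h` takes real values on the fundamental domain `F`: each `r ≥ 1` and each `r ≤ 0`
is attained exactly once, no `r` in `(0, 1)` is attained, and only `r = 0, 1` are attained on the
boundary. The symmetry `h(1 - conj z) = 1 - conj h(z)` exchanges `r` and `1 - r` and reduces this to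
the left half `Re z ≤ 1 / 2` and `r ≥ 1`.

The analytic core is the inequality `Im h' < 0` for `0 < Re z < 1 / 2`, `Im z ≥ √3 / 2`
(`im_deriv_equivariantFun_neg`). With `A = ∑ σ₅(n) qⁿ`, `B = ∑ n σ₅(n) qⁿ`, `C = ∑ n² σ₅(n) qⁿ` one
has `h' = 7 + (1 - 504 A) C / (84 B²)`, and in this strip `‖q‖ ≤ 1 / 230`, so that the inequality
follows from the first coefficients and bounds for the tails (`im_key_neg`). It makes `h` injective
on the strip, and makes `Im h` strictly decreasing along horizontal segments. As `Im h` is positive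
on `Re z = 0` and negative on `Re z = 1 / 2`, the real locus of `h` in the strip is a curve, the
graph of a continuous function of `Im z` (`exists_continuousOn_real_locus`), along which `h` is
injective and tends to `+∞`.

The curve starts inside the unit disc and ends outside of it. Since `h` maps the unit circle to
itself (`norm_equivariantFun_of_norm_eq_one`) and `Re h > -1` on the strip, a crossing of the circle
can only happen where `h = 1`; by injectivity there is exactly one crossing, and the part of the
curve in `F` is the part where `h ≥ 1`.
-/

namespace EisensteinSix

open Complex ArithmeticFunction
open scoped Real ArithmeticFunction.sigma ComplexConjugate ModularForm Manifold

/-! ### Power series with divisor-sum coefficients -/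

/-- The variable `q = exp(2πiz)`. -/
noncomputable def nome (z : ℂ) : ℂ := cexp (2 * π * Complex.I * z)

/-- The series `∑ n ^ k σ₅(n) q ^ n` at `q = exp(2πiz)`: the `k`-th iterate of `q d/dq` applied to
`∑ σ₅(n) q ^ n`. -/
noncomputable def sigmaSeries (k : ℕ) (z : ℂ) : ℂ :=
  ∑' n : ℕ, ((n : ℝ) ^ k * σ 5 n : ℝ) * nome z ^ n

lemma norm_nome (z : ℂ) : ‖nome z‖ = Real.exp (-(2 * π * z.im)) := by
  rw [nome, Complex.norm_exp]; congr 1; simp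

lemma sigma_coeff_le (k n : ℕ) : (n : ℝ) ^ k * σ 5 n ≤ (n : ℝ) ^ (k + 6) := by
  have : ((σ 5 n : ℕ) : ℝ) ≤ (n : ℝ) ^ 6 := by exact_mod_cast sigma_le_pow_succ 5 n
  rw [pow_add]; gcongr

lemma summable_coeff_mul_pow (k : ℕ) {q : ℂ} (hq : ‖q‖ < 1) :
    Summable fun n : ℕ => (((n : ℝ) ^ k * σ 5 n : ℝ) : ℂ) * q ^ n := by
  refine Summable.of_norm_bounded (summable_norm_pow_mul_geometric_of_norm_lt_one (k + 6) hq) ?_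
  intro n
  rw [norm_mul, norm_mul, Complex.norm_real, norm_pow, norm_pow, Complex.norm_natCast,
    Real.norm_of_nonneg (by positivity)]
  gcongr
  exact sigma_coeff_le k n

lemma hasDerivAt_sigmaSeries (k : ℕ) {z : ℂ} (hz : 0 < z.im) :
    HasDerivAt (sigmaSeries k) (2 * π * Complex.I * sigmaSeries (k + 1) z) z := by
  have hr1 : ‖Real.exp (-(2 * π * (z.im / 2)))‖ < 1 := by
    rw [Real.norm_of_nonneg (Real.exp_pos _).le, Real.exp_lt_one_iff]
    have := Real.pi_pos
    have : 0 < 2 * π * (z.im / 2) := by positivity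
    linarith
  have hpc : IsPreconnected {w : ℂ | z.im / 2 < w.im} := (convex_halfSpace_im_gt _).isPreconnected
  have := hasDerivAt_tsum_of_isPreconnected (𝕜 := ℂ)
    (g := fun (n : ℕ) (w : ℂ) => (((n : ℝ) ^ k * σ 5 n : ℝ) : ℂ) * nome w ^ n)
    (g' := fun (n : ℕ) (w : ℂ) =>
      2 * π * Complex.I * ((((n : ℝ) ^ (k + 1) * σ 5 n : ℝ) : ℂ) * nome w ^ n))
    (u := fun n : ℕ => 2 * π * ‖(n : ℝ) ^ (k + 7) * Real.exp (-(2 * π * (z.im / 2))) ^ n‖)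
    (t := {w : ℂ | z.im / 2 < w.im}) (y₀ := z) (y := z)
    ((summable_norm_pow_mul_geometric_of_norm_lt_one (k + 7) hr1).mul_left _)
    (isOpen_lt continuous_const Complex.continuous_im) hpc ?_ ?_ (by simp; linarith) ?_
    (by simp; linarith)
  · rw [tsum_mul_left] at this
    exact this
  · intro n w _
    have h1 : HasDerivAt (fun w : ℂ => cexp (2 * π * Complex.I * w)) (cexp (2 * π * Complex.I * w) *
      (2 * π * Complex.I)) w := by
      simpa using ((hasDerivAt_id w).const_mul (2 * π * Complex.I : ℂ)).cexp
    refine ((HasDerivAt.pow (f := nome) h1 n).const_mul _).congr_deriv ?_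
    rcases n with _ | n
    · simp
    · rw [nome]
      push_cast
      ring
  · intro n w hw
    rw [norm_mul _ (_ * nome w ^ n), norm_mul _ (nome w ^ n), norm_pow, norm_nome,
      Complex.norm_real, Real.norm_of_nonneg (by positivity), Real.norm_of_nonneg (by positivity)]
    have h2 : ‖(2 * π * Complex.I : ℂ)‖ = 2 * π := by
      simp [abs_of_pos Real.pi_pos]
    rw [h2]
    have := Real.pi_pos
    have hw' : z.im / 2 ≤ w.im := le_of_lt hw
    gcongr
    exact sigma_coeff_le (k + 1) n
  · apply summable_coeff_mul_pow
    rw [norm_nome, Real.exp_lt_one_iff]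
    have := Real.pi_pos
    have : 0 < 2 * π * z.im := by positivity
    linarith

/-- The tail of `sigmaSeries k` from the `N`-th term on, divided by `q ^ N`, as a function of
`q`. -/
noncomputable def sigmaTail (k N : ℕ) (q : ℂ) : ℂ :=
  ∑' j : ℕ, (((j + N : ℕ) : ℝ) ^ k * σ 5 (j + N) : ℝ) * q ^ j

lemma sigmaSeries_eq_sum_add_tail (k N : ℕ) {z : ℂ} (hz : 0 < z.im) :
    sigmaSeries k z = ∑ n ∈ Finset.range N, ((n : ℝ) ^ k * σ 5 n : ℝ) * nome z ^ n +
      nome z ^ N * sigmaTail k N (nome z) := by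
  have hq : ‖nome z‖ < 1 := by
    rw [norm_nome, Real.exp_lt_one_iff]
    have := Real.pi_pos
    have : 0 < 2 * π * z.im := by positivity
    linarith
  rw [sigmaSeries, ← (summable_coeff_mul_pow k hq).sum_add_tsum_nat_add N, sigmaTail,
    ← tsum_mul_left]
  congr 1
  refine tsum_congr fun j => ?_
  ring

lemma abs_im_pow_le {q : ℂ} {t : ℝ} (hq : ‖q‖ ≤ t) (n : ℕ) :
    |(q ^ n).im| ≤ n * t ^ (n - 1) * |q.im| := by
  have ht : 0 ≤ t := (norm_nonneg q).trans hq
  induction n with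
  | zero => simp
  | succ n ih =>
    rw [pow_succ, Complex.mul_im]
    have h1 : |(q ^ n).re| ≤ t ^ n :=
      (Complex.abs_re_le_norm _).trans (by rw [norm_pow]; gcongr)
    have h2 : |q.re| ≤ t := (Complex.abs_re_le_norm _).trans hq
    calc |(q ^ n).re * q.im + (q ^ n).im * q.re|
        ≤ |(q ^ n).re| * |q.im| + |(q ^ n).im| * |q.re| := by
          rw [← abs_mul, ← abs_mul]; exact abs_add_le _ _
      _ ≤ t ^ n * |q.im| + (n * t ^ (n - 1) * |q.im|) * t := by gcongr
      _ = ((n + 1 : ℕ) : ℝ) * t ^ (n + 1 - 1) * |q.im| := by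
          rcases n with _ | n
          · simp
          · simp only [Nat.add_sub_cancel]; push_cast; ring

/-- Beyond `n = N` the sequence `n ^ m` grows by a factor of at most `6` at each step as soon as it
does so at `N`. -/
lemma coeff_mul_six_pow {m N : ℕ} (hN : 0 < N) (h : (N + 1) ^ m ≤ 6 * N ^ m) (j : ℕ) :
    ((j + N : ℕ) : ℝ) ^ m ≤ (N : ℝ) ^ m * 6 ^ j := by
  have hN' : (0 : ℝ) < N := by exact_mod_cast hN
  induction j with
  | zero => simp
  | succ j ih =>
    have h' : ((N : ℝ) + 1) ^ m ≤ 6 * (N : ℝ) ^ m := by exact_mod_cast h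
    have h1 : ((j + 1 + N : ℕ) : ℝ) ≤ ((j + N : ℕ) : ℝ) * ((N + 1) / N) := by
      rw [mul_div_assoc', le_div_iff₀ hN']
      push_cast
      nlinarith [(Nat.cast_nonneg j : (0 : ℝ) ≤ j)]
    calc ((j + 1 + N : ℕ) : ℝ) ^ m ≤ (((j + N : ℕ) : ℝ) * ((N + 1) / N)) ^ m := by gcongr
      _ = ((j + N : ℕ) : ℝ) ^ m * (((N : ℝ) + 1) ^ m / (N : ℝ) ^ m) := by rw [mul_pow, div_pow]
      _ ≤ ((N : ℝ) ^ m * 6 ^ j) * 6 := by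
          gcongr
          rw [div_le_iff₀ (by positivity)]; exact h'
      _ = _ := by ring

/-- The pair of bounds `‖X‖ ≤ M` and `|Im X| ≤ L b`. For `X` a power series in `q` with real
coefficients and `b = Im q` the second bound captures that `X` is real for real `q`. -/
structure RealBound (b : ℝ) (X : ℂ) (M L : ℝ) : Prop where
  norm_le : ‖X‖ ≤ M
  im_le : |X.im| ≤ L * b

lemma realBound_sigmaTail {q : ℂ} (hq : ‖q‖ ≤ 1 / 230) (hb : 0 ≤ q.im) (k N : ℕ) (hN : 0 < N)
    (h : (N + 1) ^ (k + 6) ≤ 6 * N ^ (k + 6)) :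
    RealBound q.im (sigmaTail k N q) (103 / 100 * (N : ℝ) ^ (k + 6))
      (64 / 10 * (N : ℝ) ^ (k + 6)) := by
  have hc : ∀ j : ℕ, (((j + N : ℕ) : ℝ) ^ k * σ 5 (j + N) : ℝ) ≤ (N : ℝ) ^ (k + 6) * 6 ^ j :=
    fun j => (sigma_coeff_le k (j + N)).trans (coeff_mul_six_pow hN h j)
  have hc0 : ∀ j : ℕ, 0 ≤ (((j + N : ℕ) : ℝ) ^ k * σ 5 (j + N) : ℝ) := fun j => by positivity
  have hg : HasSum (fun j : ℕ => (N : ℝ) ^ (k + 6) * (6 / 230 : ℝ) ^ j)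
      ((N : ℝ) ^ (k + 6) * (1 - 6 / 230)⁻¹) :=
    (hasSum_geometric_of_lt_one (by norm_num) (by norm_num)).mul_left _
  have hterm : ∀ j : ℕ, ‖((((j + N : ℕ) : ℝ) ^ k * σ 5 (j + N) : ℝ) : ℂ) * q ^ j‖ ≤
      (N : ℝ) ^ (k + 6) * (6 / 230 : ℝ) ^ j := by
    intro j
    rw [norm_mul, norm_pow, Complex.norm_real, Real.norm_of_nonneg (hc0 j)]
    calc _ ≤ ((N : ℝ) ^ (k + 6) * 6 ^ j) * (1 / 230) ^ j := by
          refine mul_le_mul (hc j) ?_ (by positivity) (by positivity)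
          gcongr
      _ = _ := by rw [mul_assoc, ← mul_pow]; norm_num
  have hsum : Summable fun j : ℕ => ((((j + N : ℕ) : ℝ) ^ k * σ 5 (j + N) : ℝ) : ℂ) * q ^ j :=
    Summable.of_norm_bounded hg.summable hterm
  constructor
  · refine (tsum_of_norm_bounded hg hterm).trans ?_
    have : (0 : ℝ) ≤ (N : ℝ) ^ (k + 6) := by positivity
    rw [mul_comm]
    gcongr
    norm_num
  · have hg0 : HasSum (fun j : ℕ => (j : ℝ) * (6 / 230 : ℝ) ^ j) ((6 / 230) / (1 - 6 / 230) ^ 2) :=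
      hasSum_coe_mul_geometric_of_norm_lt_one (by rw [Real.norm_eq_abs, abs_lt]; norm_num)
    have hg' : HasSum (fun j : ℕ => (N : ℝ) ^ (k + 6) * q.im * 230 * (j * (6 / 230 : ℝ) ^ j))
        ((N : ℝ) ^ (k + 6) * q.im * 230 * ((6 / 230) / (1 - 6 / 230) ^ 2)) :=
      hg0.mul_left _
    have hterm' : ∀ j : ℕ, ‖(((((j + N : ℕ) : ℝ) ^ k * σ 5 (j + N) : ℝ) : ℂ) * q ^ j).im‖ ≤
        (N : ℝ) ^ (k + 6) * q.im * 230 * (j * (6 / 230 : ℝ) ^ j) := by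
      intro j
      rw [Complex.im_ofReal_mul, norm_mul, Real.norm_of_nonneg (hc0 j), Real.norm_eq_abs]
      calc _ ≤ ((N : ℝ) ^ (k + 6) * 6 ^ j) * (j * (1 / 230) ^ (j - 1) * |q.im|) :=
            mul_le_mul (hc j) (abs_im_pow_le hq j) (abs_nonneg _) (by positivity)
        _ = _ := by
          rw [abs_of_nonneg hb]
          rcases j with _ | j
          · simp
          · simp only [Nat.add_sub_cancel]
            rw [div_pow, div_pow, one_pow, pow_succ (230 : ℝ)]; field_simp
    have hle := tsum_of_norm_bounded hg' hterm'
    rw [← Complex.im_tsum hsum, Real.norm_eq_abs] at hle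
    refine hle.trans ?_
    have : (0 : ℝ) ≤ (N : ℝ) ^ (k + 6) * q.im := by positivity
    calc _ = (N : ℝ) ^ (k + 6) * q.im * (230 * ((6 / 230) / (1 - 6 / 230) ^ 2)) := by ring
      _ ≤ (N : ℝ) ^ (k + 6) * q.im * (64 / 10) := by gcongr; norm_num
      _ = _ := by ring

namespace RealBound

variable {b : ℝ} {X Y : ℂ} {M L M' L' : ℝ}

lemma mono (h : RealBound b X M L) (hb : 0 ≤ b) (hM : M ≤ M') (hL : L ≤ L') :
    RealBound b X M' L' :=
  ⟨h.norm_le.trans hM, h.im_le.trans (by gcongr)⟩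

lemma add (hX : RealBound b X M L) (hY : RealBound b Y M' L') :
    RealBound b (X + Y) (M + M') (L + L') := by
  refine ⟨(norm_add_le _ _).trans (add_le_add hX.norm_le hY.norm_le), ?_⟩
  rw [Complex.add_im, add_mul]
  exact (abs_add_le _ _).trans (add_le_add hX.im_le hY.im_le)

lemma neg (hX : RealBound b X M L) : RealBound b (-X) M L :=
  ⟨by simpa using hX.norm_le, by simpa using hX.im_le⟩

lemma sub (hX : RealBound b X M L) (hY : RealBound b Y M' L') :
    RealBound b (X - Y) (M + M') (L + L') := by
  simpa [sub_eq_add_neg] using hX.add hY.neg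

lemma star (hX : RealBound b X M L) : RealBound b (starRingEnd ℂ X) M L :=
  ⟨by simpa using hX.norm_le, by simpa using hX.im_le⟩

lemma mul (hX : RealBound b X M L) (hY : RealBound b Y M' L') :
    RealBound b (X * Y) (M * M') (M * L' + L * M') := by
  have hM := (norm_nonneg X).trans hX.norm_le
  refine ⟨by rw [norm_mul]; gcongr; exacts [hX.norm_le, hY.norm_le], ?_⟩
  have h1 := (Complex.abs_re_le_norm X).trans hX.norm_le
  have h2 := (Complex.abs_re_le_norm Y).trans hY.norm_le
  have h3 := (abs_nonneg _).trans hX.im_le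
  rw [Complex.mul_im]
  calc |X.re * Y.im + X.im * Y.re| ≤ |X.re| * |Y.im| + |X.im| * |Y.re| := by
        rw [← abs_mul, ← abs_mul]; exact abs_add_le _ _
    _ ≤ M * (L' * b) + (L * b) * M' := by
        gcongr
        exacts [hY.im_le, hX.im_le]
    _ = _ := by ring

lemma ofNat (n : ℕ) [n.AtLeastTwo] : RealBound b (OfNat.ofNat n : ℂ) (OfNat.ofNat n : ℝ) 0 :=
  ⟨by simp, by simp⟩

lemma one : RealBound b (1 : ℂ) (1 : ℝ) 0 := ⟨by simp, by simp⟩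

lemma self {q : ℂ} (hq : ‖q‖ ≤ M) (hb : 0 ≤ q.im) : RealBound q.im q M 1 :=
  ⟨hq, by rw [abs_of_nonneg hb, one_mul]⟩

end RealBound

/-! ### Numerical estimates in the disc `‖q‖ ≤ 1 / 230` -/

lemma exp_five_ge : (148.4 : ℝ) ≤ Real.exp 5 := by
  have h : Real.exp 5 = Real.exp 1 ^ 5 := by rw [← Real.exp_nat_mul]; norm_num
  rw [h]
  calc (148.4 : ℝ) ≤ 2.71828 ^ 5 := by norm_num
    _ ≤ _ := by
      have := Real.exp_one_gt_d9
      gcongr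
      linarith

/-- The fundamental domain lies in `Im z ≥ √3 / 2`, where `‖q‖ ≤ exp(-π√3) < 1 / 230`. -/
lemma norm_nome_le {z : ℂ} (hz : √3 / 2 ≤ z.im) : ‖nome z‖ ≤ 1 / 230 := by
  rw [norm_nome, Real.exp_neg, one_div]
  have h3 : (1.73205 : ℝ) ≤ √3 := Real.le_sqrt_of_sq_le (by norm_num)
  have hpi := Real.pi_gt_d6
  have h1 : (5.4413 : ℝ) ≤ 2 * π * z.im := by nlinarith
  have h5 := exp_five_ge
  have h4 : (1.553 : ℝ) ≤ Real.exp 0.4413 := by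
    refine le_trans ?_ (Real.sum_le_exp_of_nonneg (by norm_num) 5)
    norm_num [Finset.sum_range_succ, Nat.factorial]
  have : (230 : ℝ) ≤ Real.exp (2 * π * z.im) := by
    calc (230 : ℝ) ≤ 148.4 * 1.553 := by norm_num
      _ ≤ Real.exp 5 * Real.exp 0.4413 := by gcongr
      _ = Real.exp 5.4413 := by rw [← Real.exp_add]; norm_num
      _ ≤ _ := Real.exp_le_exp.mpr h1
  gcongr

/-! In this section `G`, `U`, `K` stand for the tails `sigmaTail 0 3 q`, `sigmaTail 1 4 q`,
`sigmaTail 2 4 q`, so that `∑ σ₅(n) qⁿ = q α`, `∑ n σ₅(n) qⁿ = q u` and `∑ n² σ₅(n) qⁿ = q κ` with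
`α = 1 + 33 q + q² G`, `u = 1 + 66 q + 732 q² + q³ U`, `κ = 1 + 132 q + 2196 q² + q³ K`. -/

section Estimates

variable {q G U K : ℂ}

lemma realBound_quadratic_add_tail_A (hq : ‖q‖ ≤ 1 / 230) (hb : 0 ≤ q.im)
    (hG : RealBound q.im G (103 / 100 * 3 ^ 6) (64 / 10 * 3 ^ 6)) :
    RealBound q.im (33 * q + q ^ 2 * G) (158 / 1000) 40 := by
  have h := RealBound.self hq hb
  have h2 : RealBound q.im (q * q * G) _ _ := ((h.mul h).mul hG)
  rw [← sq] at h2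
  exact ((((RealBound.ofNat 33).mul h).add h2)).mono hb (by norm_num) (by norm_num)

lemma im_one_add_A_nonneg (hq : ‖q‖ ≤ 1 / 230) (hb : 0 ≤ q.im)
    (hG : RealBound q.im G (103 / 100 * 3 ^ 6) (64 / 10 * 3 ^ 6)) :
    0 ≤ (1 + 33 * q + q ^ 2 * G).im := by
  have h := RealBound.self hq hb
  have h2 : RealBound q.im (q * q * G) _ _ := ((h.mul h).mul hG)
  have h3 := (abs_le.mp h2.im_le).1
  have : (1 + 33 * q + q ^ 2 * G).im = 33 * q.im + (q * q * G).im := by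
    rw [sq]; simp [-Complex.mul_im, Complex.add_im]
    simp
  rw [this]
  nlinarith

lemma realBound_B (hq : ‖q‖ ≤ 1 / 230) (hb : 0 ≤ q.im)
    (hU : RealBound q.im U (103 / 100 * 4 ^ 7) (64 / 10 * 4 ^ 7)) :
    RealBound q.im (66 * q + 732 * q ^ 2 + q ^ 3 * U) (303 / 1000) (7334 / 100) := by
  have h := RealBound.self hq hb
  have h2 : RealBound q.im (q * q) _ _ := h.mul h
  have h3 : RealBound q.im (q * q * q * U) _ _ := (h2.mul h).mul hU
  have : 66 * q + 732 * q ^ 2 + q ^ 3 * U = 66 * q + 732 * (q * q) + q * q * q * U := by ring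
  rw [this]
  exact ((((RealBound.ofNat 66).mul h).add ((RealBound.ofNat 732).mul h2)).add h3).mono hb
    (by norm_num) (by norm_num)

/-- The variable part of `D = (κ - u²) / q²`, whose constant term is `-3624`. -/
lemma realBound_D (hq : ‖q‖ ≤ 1 / 230) (hb : 0 ≤ q.im)
    (hU : RealBound q.im U (103 / 100 * 4 ^ 7) (64 / 10 * 4 ^ 7))
    (hK : RealBound q.im K (103 / 100 * 4 ^ 8) (64 / 10 * 4 ^ 8)) :
    RealBound q.im (-96624 * q - 535824 * q ^ 2 + q * K - q * U * (2 + 132 * q + 1464 * q ^ 2)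
      - q ^ 4 * U ^ 2) 916 227000 := by
  have h := RealBound.self hq hb
  have h2 : RealBound q.im (q * q) _ _ := h.mul h
  have hp : RealBound q.im (2 + 132 * q + 1464 * (q * q)) _ _ :=
    ((RealBound.ofNat 2).add ((RealBound.ofNat 132).mul h)).add ((RealBound.ofNat 1464).mul h2)
  have := (((((((RealBound.ofNat 96624).mul h).neg).sub ((RealBound.ofNat 535824).mul h2)).add
    (h.mul hK)).sub ((h.mul hU).mul hp)).sub ((h2.mul h2).mul (hU.mul hU)))
  have h' := this.mono (M' := 916) (L' := 227000) hb (by norm_num) (by norm_num)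
  convert h' using 1
  ring

/-- The numerical inequality for `im_key_neg` when `Re q ≤ 0`, with `m = ‖u‖`. Here `4540`,
`227000` bound `D`, `74` bounds `|Im u| / Im q`, and `1.026`, `40` bound `α`, in the sense of
`RealBound`. -/
lemma key_bound_left {m : ℝ} (hm : 697 / 1000 ≤ m) :
    (4540 * m ^ 2 + (4540 * (2 * m * 74) + 227000 * m ^ 2) / 230 +
      504 / 230 ^ 2 * (1.026 * (4540 * (2 * m * 74) + 227000 * m ^ 2) + 40 * (4540 * m ^ 2)))
      / 230 ^ 2 < m ^ 4 := by
  have : 0.1788 * m + 0.1794 < m ^ 3 := by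
    nlinarith [sq_nonneg (m - 0.697), mul_nonneg (sub_nonneg.2 hm) (sq_nonneg m)]
  nlinarith

/-- The counterpart of `key_bound_left` for `Re q ≥ 0`; the summand with `1008` comes from
`2 (Re q) (Im q) Re (α ψ)`, whose sign is only known for `Re q ≤ 0`. -/
lemma key_bound_right {m : ℝ} (hm : 984 / 1000 ≤ m) :
    (4540 * m ^ 2 + (4540 * (2 * m * 74) + 227000 * m ^ 2) / 230 +
      504 / 230 ^ 2 * (1.158 * (4540 * (2 * m * 74) + 227000 * m ^ 2) + 40 * (4540 * m ^ 2)) +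
      1008 / 230 * (1.158 * (4540 * m ^ 2)))
      / 230 ^ 2 < m ^ 4 := by
  have : 0.62 * m + 0.196 < m ^ 3 := by
    nlinarith [sq_nonneg (m - 0.984), mul_nonneg (sub_nonneg.2 hm) (sq_nonneg m)]
  nlinarith

lemma norm_one_add_A_le_of_re_nonpos (hq : ‖q‖ ≤ 1 / 230) (ha : q.re ≤ 0)
    (hG : ‖G‖ ≤ 103 / 100 * 3 ^ 6) : ‖1 + 33 * q + q ^ 2 * G‖ ≤ 1026 / 1000 := by
  have h0 : ‖q‖ ^ 2 = q.re ^ 2 + q.im ^ 2 := by rw [Complex.sq_norm, Complex.normSq_apply]; ring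
  have h00 : ‖q‖ ^ 2 ≤ (1 / 230) ^ 2 := by gcongr
  have h1 : ‖1 + 33 * q‖ ^ 2 ≤ (1011 / 1000) ^ 2 := by
    rw [Complex.sq_norm, Complex.normSq_apply]
    simp
    nlinarith
  have h2 := abs_le_of_sq_le_sq' h1 (by norm_num)
  calc ‖1 + 33 * q + q ^ 2 * G‖ ≤ ‖1 + 33 * q‖ + ‖q‖ ^ 2 * ‖G‖ := by
        refine (norm_add_le _ _).trans ?_
        rw [norm_mul, norm_pow]
    _ ≤ 1011 / 1000 + (1 / 230) ^ 2 * (103 / 100 * 3 ^ 6) := by gcongr; exact h2.2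
    _ ≤ _ := by norm_num

lemma norm_one_add_B_ge (hq : ‖q‖ ≤ 1 / 230) (hb : 0 ≤ q.im)
    (hU : RealBound q.im U (103 / 100 * 4 ^ 7) (64 / 10 * 4 ^ 7)) :
    697 / 1000 ≤ ‖1 + (66 * q + 732 * q ^ 2 + q ^ 3 * U)‖ := by
  have h1 := (realBound_B hq hb hU).norm_le
  have h2 := norm_sub_le (1 + (66 * q + 732 * q ^ 2 + q ^ 3 * U))
    (66 * q + 732 * q ^ 2 + q ^ 3 * U)
  rw [add_sub_cancel_right, norm_one] at h2
  linarith

lemma norm_one_add_B_ge_of_re_nonneg (hq : ‖q‖ ≤ 1 / 230) (ha : 0 ≤ q.re)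
    (hU : ‖U‖ ≤ 103 / 100 * 4 ^ 7) :
    984 / 1000 ≤ ‖1 + (66 * q + 732 * q ^ 2 + q ^ 3 * U)‖ := by
  have h0 : ‖q‖ ^ 2 = q.re ^ 2 + q.im ^ 2 := by rw [Complex.sq_norm, Complex.normSq_apply]; ring
  have h00 : ‖q‖ ^ 2 ≤ (1 / 230) ^ 2 := by gcongr
  refine le_trans ?_ (Complex.re_le_norm _)
  have h1 : ‖q ^ 3 * U‖ ≤ (1 / 230) ^ 3 * (103 / 100 * 4 ^ 7) := by
    rw [norm_mul, norm_pow]; gcongr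
  have h2 := (abs_le.mp ((Complex.abs_re_le_norm _).trans h1)).1
  have h3 : (1 + (66 * q + 732 * q ^ 2 + q ^ 3 * U)).re =
      1 + 66 * q.re + 732 * (q.re ^ 2 - q.im ^ 2) + (q ^ 3 * U).re := by
    rw [Complex.add_re, Complex.add_re, Complex.add_re, sq]
    simp [-Complex.mul_re, Complex.mul_re 66, Complex.mul_re 732]
    simp
    ring
  rw [h3]
  nlinarith [sq_nonneg q.re]

/-- The inequality `Im ((1 - 504 A) C conj(B)²) < 0` for `A = q α`, `B = q u`, `C = q κ`. With
`κ = u² + q² D`, the leading part `|u|⁴ (conj q - 504 |q|² α)` has negative imaginary part and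
dominates the correction by `D`. -/
lemma im_key_neg (hq : ‖q‖ ≤ 1 / 230) (hb : 0 < q.im)
    (hG : RealBound q.im G (103 / 100 * 3 ^ 6) (64 / 10 * 3 ^ 6))
    (hU : RealBound q.im U (103 / 100 * 4 ^ 7) (64 / 10 * 4 ^ 7))
    (hK : RealBound q.im K (103 / 100 * 4 ^ 8) (64 / 10 * 4 ^ 8)) :
    ((1 - 504 * (q * (1 + 33 * q + q ^ 2 * G))) *
      (q * (1 + 132 * q + 2196 * q ^ 2 + q ^ 3 * K)) *
      conj (q * (1 + (66 * q + 732 * q ^ 2 + q ^ 3 * U))) ^ 2).im < 0 := by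
  have hq0 : 0 < ‖q‖ := norm_pos_iff.mpr fun h => by simp [h] at hb
  have hαi := im_one_add_A_nonneg hq hb.le hG
  have hα1 := realBound_quadratic_add_tail_A hq hb.le hG
  have hαl := fun ha => norm_one_add_A_le_of_re_nonpos hq ha hG.norm_le
  have hB := realBound_B hq hb.le hU
  have hm := norm_one_add_B_ge hq hb.le hU
  have hmr := fun ha => norm_one_add_B_ge_of_re_nonneg hq ha hU.norm_le
  have hD' := realBound_D hq hb.le hU hK
  set D' := -96624 * q - 535824 * q ^ 2 + q * K - q * U * (2 + 132 * q + 1464 * q ^ 2)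
      - q ^ 4 * U ^ 2 with hD'def
  set u := 1 + (66 * q + 732 * q ^ 2 + q ^ 3 * U) with hu
  set α := 1 + 33 * q + q ^ 2 * G with hα
  have hα1' : ‖α - 1‖ ≤ 158 / 1000 := by
    have : α - 1 = 33 * q + q ^ 2 * G := by rw [hα]; ring
    rw [this]; exact hα1.norm_le
  have hαb : RealBound q.im α (1158 / 1000) 40 := by
    have := RealBound.one.add hα1
    rw [← add_assoc] at this
    exact this.mono hb.le (by norm_num) (by norm_num)
  have hui : |u.im| ≤ 7334 / 100 * q.im := by simpa [hu] using hB.im_le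
  have hκ : 1 + 132 * q + 2196 * q ^ 2 + q ^ 3 * K = u ^ 2 + q ^ 2 * (-3624 + D') := by
    rw [hu, hD'def]; ring
  rw [hκ]
  clear_value D' u α
  set a := q.re
  set b := q.im with hbdef
  set t := ‖q‖ with ht
  set m := ‖u‖ with hmdef
  have ht2 : t ^ 2 = a ^ 2 + b ^ 2 := by rw [ht, Complex.sq_norm, Complex.normSq_apply]; ring
  have ht0 : 0 < t ^ 2 := by positivity
  have ht1 : t ^ 2 ≤ (1 / 230) ^ 2 := by gcongr
  have hat : |a| ≤ 1 / 230 := (Complex.abs_re_le_norm q).trans hq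
  have hm0 : 0 ≤ m := norm_nonneg _
  have hmsq : m ^ 2 = u.re ^ 2 + u.im ^ 2 := by
    rw [hmdef, Complex.sq_norm, Complex.normSq_apply]; ring
  -- the correction `ψ = D conj(u)²`
  have hD : RealBound b (-3624 + D') 4540 227000 :=
    ((RealBound.ofNat 3624).neg.add hD').mono hb.le (by norm_num) (by norm_num)
  have hub : RealBound b (conj u) m 74 :=
    (RealBound.star ⟨le_rfl, hui⟩).mono hb.le le_rfl (by norm_num)
  set ψ := (-3624 + D') * (conj u * conj u) with hψ
  have hψb : RealBound b ψ (4540 * m ^ 2) (4540 * (2 * m * 74) + 227000 * m ^ 2) := by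
    have := hD.mul (hub.mul hub)
    refine this.mono hb.le (le_of_eq (by ring)) (le_of_eq (by ring))
  have hE : (1 - 504 * (q * α)) * (q * (u ^ 2 + q ^ 2 * (-3624 + D'))) * conj (q * u) ^ 2 =
      ((t ^ 2 : ℝ) : ℂ) * (((m ^ 4 : ℝ) : ℂ) * conj q - ((504 * t ^ 2 * m ^ 4 : ℝ) : ℂ) * α
        + ((t ^ 2 : ℝ) : ℂ) * (q * ψ) - ((504 * t ^ 2 : ℝ) : ℂ) * (q ^ 2 * (α * ψ))) := by
    have h1 : ((t ^ 2 : ℝ) : ℂ) = q * conj q := by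
      rw [ht, Complex.mul_conj, Complex.sq_norm]
    have h2 : ((m ^ 2 : ℝ) : ℂ) = u * conj u := by
      rw [hmdef, Complex.mul_conj, Complex.sq_norm]
    have h3 : ((m ^ 4 : ℝ) : ℂ) = (u * conj u) ^ 2 := by
      rw [← h2]; push_cast; ring
    have h4 : ((504 * t ^ 2 * m ^ 4 : ℝ) : ℂ) = 504 * (q * conj q) * (u * conj u) ^ 2 := by
      rw [← h3, ← h1]; push_cast; ring
    have h5 : ((504 * t ^ 2 : ℝ) : ℂ) = 504 * (q * conj q) := by
      rw [← h1]; push_cast; ring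
    rw [h1, h3, h4, h5, hψ, map_mul]
    ring
  have him1 : (q * ψ).im = a * ψ.im + b * ψ.re := by rw [Complex.mul_im]
  have him2 : ∀ ω : ℂ, (q ^ 2 * ω).im = 2 * a * b * ω.re + (a ^ 2 - b ^ 2) * ω.im := by
    intro ω; rw [sq, Complex.mul_im, Complex.mul_re, Complex.mul_im]; ring
  rw [hE, Complex.im_ofReal_mul]
  refine mul_neg_of_pos_of_neg ht0 ?_
  rw [Complex.sub_im, Complex.add_im, Complex.sub_im, Complex.im_ofReal_mul,
    Complex.im_ofReal_mul, Complex.im_ofReal_mul, Complex.im_ofReal_mul, him1, him2,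
    Complex.conj_im, ← hbdef]
  clear hE him1 him2
  have hψr : ψ.re ≤ 4540 * m ^ 2 := (Complex.re_le_norm _).trans hψb.norm_le
  have haψ : a * ψ.im ≤ 1 / 230 * ((4540 * (2 * m * 74) + 227000 * m ^ 2) * b) := by
    refine (le_abs_self _).trans ?_
    rw [abs_mul]
    exact mul_le_mul hat hψb.im_le (abs_nonneg _) (by norm_num)
  have hab : |a ^ 2 - b ^ 2| ≤ (1 / 230) ^ 2 := by
    rw [abs_le]; constructor <;> nlinarith [sq_nonneg a, sq_nonneg b]
  have hfirst : 0 ≤ 504 * t ^ 2 * m ^ 4 * α.im := by positivity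
  -- it remains to bound the last bracket by `c b` for the relevant constant `c`
  suffices H : ∃ c : ℝ, c / 230 ^ 2 < m ^ 4 ∧ 0 ≤ c ∧
      (a * ψ.im + b * ψ.re) - 504 * (2 * a * b * (α * ψ).re + (a ^ 2 - b ^ 2) * (α * ψ).im) ≤
        c * b by
    obtain ⟨c, hc1, hc0, hc2⟩ := H
    have h1 : t ^ 2 * (a * ψ.im + b * ψ.re) - 504 * t ^ 2 *
        (2 * a * b * (α * ψ).re + (a ^ 2 - b ^ 2) * (α * ψ).im) ≤ (1 / 230) ^ 2 * (c * b) := by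
      calc _ = t ^ 2 * ((a * ψ.im + b * ψ.re) -
            504 * (2 * a * b * (α * ψ).re + (a ^ 2 - b ^ 2) * (α * ψ).im)) := by ring
        _ ≤ t ^ 2 * (c * b) := by gcongr
        _ ≤ _ := by gcongr
    have h2 : (1 / 230) ^ 2 * (c * b) < m ^ 4 * b := by
      have := mul_lt_mul_of_pos_right hc1 hb
      linarith
    linarith
  rcases le_total a 0 with ha | ha
  · have hαb' : RealBound b α 1.026 40 := ⟨(hαl ha).trans (by norm_num), hαb.im_le⟩
    have hω := (hαb'.mul hψb).im_le
    -- `Re (α ψ) ≤ 0`, because `D` is close to `-3624` and `α conj(u)²` has positive real part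
    have hωr : (α * ψ).re ≤ 0 := by
      have e1 : α * ψ = ((-3624 : ℝ) : ℂ) * (conj u * conj u) +
          ((-3624 : ℝ) : ℂ) * ((α - 1) * (conj u * conj u)) + α * D' * (conj u * conj u) := by
        rw [hψ]; push_cast; ring
      have hn : ‖conj u * conj u‖ = m ^ 2 := by rw [norm_mul, RCLike.norm_conj, sq]
      have e2 : |((α - 1) * (conj u * conj u)).re| ≤ 158 / 1000 * m ^ 2 := by
        refine (Complex.abs_re_le_norm _).trans ?_
        rw [norm_mul, hn]; gcongr
      have e3 : |(α * D' * (conj u * conj u)).re| ≤ 1026 / 1000 * 916 * m ^ 2 := by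
        refine (Complex.abs_re_le_norm _).trans ?_
        rw [norm_mul, norm_mul, hn]
        gcongr
        exacts [hαl ha, hD'.norm_le]
      have e4 : (conj u * conj u).re = m ^ 2 - 2 * u.im ^ 2 := by
        rw [hmsq]; simp; ring
      have e5 : u.im ^ 2 ≤ (319 / 1000) ^ 2 := by
        rw [← sq_abs]
        have : b ≤ 1 / 230 := (Complex.im_le_norm q).trans hq
        gcongr
        linarith
      rw [e1, Complex.add_re, Complex.add_re, Complex.re_ofReal_mul, Complex.re_ofReal_mul, e4]
      have := (abs_le.mp e2).1
      have := (abs_le.mp e3).2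
      have : (697 / 1000) ^ 2 ≤ m ^ 2 := by gcongr
      linarith
    refine ⟨_, key_bound_left hm, by positivity, ?_⟩
    have h1 : 0 ≤ 2 * a * b * (α * ψ).re := by
      have := mul_nonneg_of_nonpos_of_nonpos ha hωr
      nlinarith
    have h2 := (abs_mul (a ^ 2 - b ^ 2) (α * ψ).im).trans_le
      (mul_le_mul hab hω (abs_nonneg _) (by norm_num))
    have h3 := (abs_le.mp h2).1
    nlinarith
  · have hω := hαb.mul hψb
    refine ⟨_, key_bound_right (hmr ha), by positivity, ?_⟩
    have h1 : |2 * a * b * (α * ψ).re| ≤ 2 * (1 / 230) * b * (1158 / 1000 * (4540 * m ^ 2)) := by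
      rw [abs_mul, abs_mul, abs_mul, abs_two, abs_of_pos hb]
      gcongr
      exact (Complex.abs_re_le_norm _).trans hω.norm_le
    have h2 := (abs_mul (a ^ 2 - b ^ 2) (α * ψ).im).trans_le
      (mul_le_mul hab hω.im_le (abs_nonneg _) (by norm_num))
    have h3 := (abs_le.mp h2).1
    have h4 := (abs_le.mp h1).1
    nlinarith

end Estimates

/-! ### The equivariant function of `E₆` -/

lemma im_pos_of_le {z : ℂ} (hz : √3 / 2 ≤ z.im) : 0 < z.im := lt_of_lt_of_le (by positivity) hz

lemma sigma_five_two : σ 5 2 = 33 := by decide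
lemma sigma_five_three : σ 5 3 = 244 := by decide

lemma sigmaSeries_zero_eq {z : ℂ} (hz : 0 < z.im) :
    sigmaSeries 0 z = nome z * (1 + 33 * nome z + nome z ^ 2 * sigmaTail 0 3 (nome z)) := by
  rw [sigmaSeries_eq_sum_add_tail 0 3 hz]
  simp [Finset.sum_range_succ, sigma_five_two]
  ring

lemma sigmaSeries_one_eq {z : ℂ} (hz : 0 < z.im) :
    sigmaSeries 1 z = nome z *
      (1 + (66 * nome z + 732 * nome z ^ 2 + nome z ^ 3 * sigmaTail 1 4 (nome z))) := by
  rw [sigmaSeries_eq_sum_add_tail 1 4 hz]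
  simp [Finset.sum_range_succ, sigma_five_two, sigma_five_three]
  ring

lemma sigmaSeries_two_eq {z : ℂ} (hz : 0 < z.im) :
    sigmaSeries 2 z = nome z *
      (1 + 132 * nome z + 2196 * nome z ^ 2 + nome z ^ 3 * sigmaTail 2 4 (nome z)) := by
  rw [sigmaSeries_eq_sum_add_tail 2 4 hz]
  simp [Finset.sum_range_succ, sigma_five_two, sigma_five_three]
  ring

lemma nome_ne_zero (z : ℂ) : nome z ≠ 0 := Complex.exp_ne_zero _

lemma nome_im (z : ℂ) : (nome z).im = Real.exp (-(2 * π * z.im)) * Real.sin (2 * π * z.re) := by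
  rw [nome, Complex.exp_im]; simp

lemma nome_re (z : ℂ) : (nome z).re = Real.exp (-(2 * π * z.im)) * Real.cos (2 * π * z.re) := by
  rw [nome, Complex.exp_re]; simp

lemma nome_im_pos {z : ℂ} (h0 : 0 < z.re) (h1 : z.re < 1 / 2) : 0 < (nome z).im := by
  rw [nome_im]
  have := Real.pi_pos
  exact mul_pos (Real.exp_pos _) (Real.sin_pos_of_pos_of_lt_pi (by positivity) (by nlinarith))

section Tails

variable {q : ℂ}

lemma realBound_tail_A (hq : ‖q‖ ≤ 1 / 230) (hb : 0 ≤ q.im) :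
    RealBound q.im (sigmaTail 0 3 q) (103 / 100 * 3 ^ 6) (64 / 10 * 3 ^ 6) := by
  simpa using realBound_sigmaTail hq hb 0 3 (by norm_num) (by norm_num)

lemma realBound_tail_B (hq : ‖q‖ ≤ 1 / 230) (hb : 0 ≤ q.im) :
    RealBound q.im (sigmaTail 1 4 q) (103 / 100 * 4 ^ 7) (64 / 10 * 4 ^ 7) := by
  simpa using realBound_sigmaTail hq hb 1 4 (by norm_num) (by norm_num)

lemma realBound_tail_C (hq : ‖q‖ ≤ 1 / 230) (hb : 0 ≤ q.im) :
    RealBound q.im (sigmaTail 2 4 q) (103 / 100 * 4 ^ 8) (64 / 10 * 4 ^ 8) := by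
  simpa using realBound_sigmaTail hq hb 2 4 (by norm_num) (by norm_num)

end Tails

/-! ### Reflection symmetry -/

lemma sigmaSeries_eq_conj {z w : ℂ} (k : ℕ) (h : nome w = conj (nome z)) :
    sigmaSeries k w = conj (sigmaSeries k z) := by
  rw [sigmaSeries, sigmaSeries, Complex.conj_tsum]
  refine tsum_congr fun n => ?_
  rw [h, map_mul, map_pow, Complex.conj_ofReal]

lemma nome_neg_conj (z : ℂ) : nome (-conj z) = conj (nome z) := by
  rw [nome, nome, ← Complex.exp_conj]; congr 1; simp [Complex.conj_ofNat]

lemma nome_one_sub_conj (z : ℂ) : nome (1 - conj z) = conj (nome z) := by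
  rw [← nome_neg_conj, nome, nome, ← Complex.exp_periodic (2 * π * Complex.I * -conj z)]
  congr 1; ring

/-- The equivariant function `h(z) = z + 6 E₆(z) / E₆'(z)`, written through the `q`-expansions
`E₆ = 1 - 504 ∑ σ₅(n) qⁿ` and `E₆' = -1008 π i ∑ n σ₅(n) qⁿ`. -/
noncomputable def equivariantFun (z : ℂ) : ℂ :=
  z + Complex.I / (168 * π) * ((1 - 504 * sigmaSeries 0 z) / sigmaSeries 1 z)

lemma equivariantFun_one_sub_conj (z : ℂ) :
    equivariantFun (1 - conj z) = 1 - conj (equivariantFun z) := by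
  have h := fun k => sigmaSeries_eq_conj k (nome_one_sub_conj z)
  simp only [equivariantFun, h, map_add, map_mul, map_div₀, map_sub, map_one, Complex.conj_I,
    Complex.conj_ofReal, map_ofNat]
  ring

/-! ### Behaviour of the equivariant function on the half strip -/

lemma conj_im_nonneg_or (q : ℂ) : 0 ≤ q.im ∨ 0 ≤ (conj q).im := by
  rw [Complex.conj_im]; rcases le_total 0 q.im with h | h
  · exact Or.inl h
  · exact Or.inr (by linarith)

lemma sigmaSeries_one_ne_zero {z : ℂ} (hz : √3 / 2 ≤ z.im) : sigmaSeries 1 z ≠ 0 := by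
  -- by reflection it is enough to treat `0 ≤ Im q`
  have key : ∀ w : ℂ, √3 / 2 ≤ w.im → 0 ≤ (nome w).im → sigmaSeries 1 w ≠ 0 := by
    intro w hw hb
    rw [sigmaSeries_one_eq (im_pos_of_le hw)]
    refine mul_ne_zero (nome_ne_zero w) fun h => ?_
    have := norm_one_add_B_ge (norm_nome_le hw) hb (realBound_tail_B (norm_nome_le hw) hb)
    rw [h, norm_zero] at this
    norm_num at this
  rcases conj_im_nonneg_or (nome z) with h | h
  · exact key z hz h
  · intro h0
    rw [← nome_neg_conj] at h
    refine key (-conj z) (by simpa using hz) h ?_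
    rw [sigmaSeries_eq_conj 1 (nome_neg_conj z), h0, _root_.map_zero]

lemma hasDerivAt_equivariantFun {z : ℂ} (hz : √3 / 2 ≤ z.im) :
    HasDerivAt equivariantFun
      (7 + (1 - 504 * sigmaSeries 0 z) * sigmaSeries 2 z / (84 * sigmaSeries 1 z ^ 2)) z := by
  have h0 := hasDerivAt_sigmaSeries 0 (im_pos_of_le hz)
  have h1 := hasDerivAt_sigmaSeries 1 (im_pos_of_le hz)
  have hne := sigmaSeries_one_ne_zero hz
  have hpi : (π : ℂ) ≠ 0 := Complex.ofReal_ne_zero.mpr Real.pi_ne_zero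
  refine ((hasDerivAt_id z).add ((((h0.const_mul 504).const_sub 1).div h1 hne).const_mul
    (Complex.I / (168 * π)))).congr_deriv ?_
  field_simp
  ring_nf
  simp only [Complex.I_sq]
  ring

lemma continuousAt_equivariantFun {z : ℂ} (hz : √3 / 2 ≤ z.im) :
    ContinuousAt equivariantFun z := (hasDerivAt_equivariantFun hz).continuousAt

/-- The key monotonicity property: `Im h' < 0` in the half strip. Since
`h' = 7 + (1 - 504 A) C / (84 B²)`, multiplying by `‖B‖⁴` reduces it to `im_key_neg`. -/
lemma im_deriv_equivariantFun_neg {z : ℂ} (hz : √3 / 2 ≤ z.im) (h0 : 0 < z.re)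
    (h1 : z.re < 1 / 2) :
    (7 + (1 - 504 * sigmaSeries 0 z) * sigmaSeries 2 z / (84 * sigmaSeries 1 z ^ 2)).im < 0 := by
  have hq := norm_nome_le hz
  have hb := nome_im_pos h0 h1
  have hz' := im_pos_of_le hz
  have key := im_key_neg hq hb (realBound_tail_A hq hb.le) (realBound_tail_B hq hb.le)
    (realBound_tail_C hq hb.le)
  rw [← sigmaSeries_zero_eq hz', ← sigmaSeries_one_eq hz', ← sigmaSeries_two_eq hz'] at key
  have hne := sigmaSeries_one_ne_zero hz
  have hpos : 0 < 84 * ‖sigmaSeries 1 z‖ ^ 4 := by positivity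
  have e : (1 - 504 * sigmaSeries 0 z) * sigmaSeries 2 z / (84 * sigmaSeries 1 z ^ 2) =
      (((84 * ‖sigmaSeries 1 z‖ ^ 4)⁻¹ : ℝ) : ℂ) *
        ((1 - 504 * sigmaSeries 0 z) * sigmaSeries 2 z * conj (sigmaSeries 1 z) ^ 2) := by
    have h4 : ((‖sigmaSeries 1 z‖ ^ 4 : ℝ) : ℂ) =
        (sigmaSeries 1 z * conj (sigmaSeries 1 z)) ^ 2 := by
      rw [Complex.mul_conj, ← Complex.sq_norm]; push_cast; ring
    have hne' : conj (sigmaSeries 1 z) ≠ 0 := (map_ne_zero _).mpr hne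
    rw [Complex.ofReal_inv, Complex.ofReal_mul, h4]
    push_cast
    field_simp
  rw [e, Complex.add_im, Complex.im_ofReal_mul]
  have := mul_neg_of_pos_of_neg (inv_pos.mpr hpos) key
  simpa using this

/-- The half strip `0 < Re z < 1 / 2`, `Im z ≥ √3 / 2`, which contains the interior of the left
half of the fundamental domain. -/
def halfStrip : Set ℂ := {z | 0 < z.re ∧ z.re < 1 / 2 ∧ √3 / 2 ≤ z.im}

lemma convex_halfStrip : Convex ℝ halfStrip :=
  (convex_halfSpace_re_gt 0).inter
    ((convex_halfSpace_re_lt _).inter (convex_halfSpace_im_ge _))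

/-- `h'` takes values in the open lower half plane on the convex set `halfStrip`, so along the
segment from `z` to `w` the imaginary part of `h · conj (w - z)` is strictly decreasing. -/
lemma injOn_equivariantFun : Set.InjOn equivariantFun halfStrip := by
  intro z hz w hw hzw
  by_contra hne
  set v := w - z with hv
  have hv0 : v ≠ 0 := sub_ne_zero.mpr (Ne.symm hne)
  have hmem : ∀ s ∈ Set.Icc (0 : ℝ) 1, z + s * v ∈ halfStrip := by
    intro s hs
    have := convex_halfStrip hz hw (sub_nonneg.mpr hs.2) hs.1 (by ring)
    convert this using 1
    simp [hv]; ring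
  have hd : ∀ s ∈ Set.Icc (0 : ℝ) 1, ∃ d : ℂ, d.im < 0 ∧
      HasDerivAt (fun s : ℝ => (equivariantFun (z + s * v) * conj v).im) (d.im * ‖v‖ ^ 2) s := by
    intro s hs
    have hm := hmem s hs
    refine ⟨_, im_deriv_equivariantFun_neg hm.2.2 hm.1 hm.2.1, ?_⟩
    have h1 : HasDerivAt (fun s : ℝ => z + s * v) v s := by
      simpa using ((Complex.ofRealCLM.hasDerivAt (x := s)).mul_const v).const_add z
    have h2 := ((hasDerivAt_equivariantFun hm.2.2).comp s h1).mul_const (conj v)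
    have h3 := Complex.imCLM.hasFDerivAt.comp_hasDerivAt s h2
    refine h3.congr_deriv ?_
    rw [Complex.imCLM_apply, mul_assoc, Complex.mul_conj, mul_comm, Complex.im_ofReal_mul,
      ← Complex.sq_norm, mul_comm]
  have hlt : (equivariantFun (z + (1 : ℝ) * v) * conj v).im <
      (equivariantFun (z + (0 : ℝ) * v) * conj v).im := by
    refine strictAntiOn_of_deriv_neg (convex_Icc (0 : ℝ) 1)
      (f := fun s : ℝ => (equivariantFun (z + s * v) * conj v).im) ?_ ?_ (by simp) (by simp)
      one_pos
    · intro s hs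
      obtain ⟨d, -, h⟩ := hd s hs
      exact h.continuousAt.continuousWithinAt
    · intro s hs
      obtain ⟨d, hd0, h⟩ := hd s (interior_subset hs)
      rw [h.deriv]
      exact mul_neg_of_neg_of_pos hd0 (by positivity)
  have e : z + (1 : ℝ) * v = w := by simp [hv]
  rw [e, Complex.ofReal_zero, zero_mul, add_zero, hzw] at hlt
  exact lt_irrefl _ hlt

lemma strictAntiOn_im_equivariantFun {y : ℝ} (hy : √3 / 2 ≤ y) :
    StrictAntiOn (fun x : ℝ => (equivariantFun (x + y * Complex.I)).im) (Set.Icc 0 (1 / 2)) := by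
  have hd : ∀ x : ℝ, HasDerivAt (fun x : ℝ => (equivariantFun (x + y * Complex.I)).im)
      (7 + (1 - 504 * sigmaSeries 0 (x + y * Complex.I)) * sigmaSeries 2 (x + y * Complex.I) /
        (84 * sigmaSeries 1 (x + y * Complex.I) ^ 2)).im x := by
    intro x
    have h1 : HasDerivAt (fun s : ℝ => (s : ℂ) + y * Complex.I) 1 x := by
      simpa using (Complex.ofRealCLM.hasDerivAt (x := x)).add_const (y * Complex.I)
    have h2 := (hasDerivAt_equivariantFun (z := x + y * Complex.I) (by simpa using hy)).comp x h1
    have h3 := Complex.imCLM.hasFDerivAt.comp_hasDerivAt x h2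
    exact h3.congr_deriv (by simp)
  refine strictAntiOn_of_deriv_neg (convex_Icc _ _)
    (fun x _ => (hd x).continuousAt.continuousWithinAt) fun x hx => ?_
  rw [interior_Icc] at hx
  rw [(hd x).deriv]
  exact im_deriv_equivariantFun_neg (by simpa using hy) (by simpa using hx.1) (by simpa using hx.2)

/-- The quotient `(1 - 504 A) / B` is `1 / q - 570` up to a bounded error. -/
lemma exists_quotient_eq {z : ℂ} (hz : √3 / 2 ≤ z.im) (hb : 0 ≤ (nome z).im) :
    ∃ W : ℂ, ‖W‖ ≤ 160 ∧
      (1 - 504 * sigmaSeries 0 z) / sigmaSeries 1 z = (nome z)⁻¹ - 570 + W := by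
  have hq := norm_nome_le hz
  have hz' := im_pos_of_le hz
  have hG := (realBound_tail_A hq hb).norm_le
  have hU := (realBound_tail_B hq hb).norm_le
  have hu := norm_one_add_B_ge hq hb (realBound_tail_B hq hb)
  have hq0 := nome_ne_zero z
  rw [sigmaSeries_zero_eq hz', sigmaSeries_one_eq hz']
  set q := nome z
  set G := sigmaTail 0 3 q
  set U := sigmaTail 1 4 q
  set u := 1 + (66 * q + 732 * q ^ 2 + q ^ 3 * U) with hudef
  have hu0 : u ≠ 0 := norm_pos_iff.mp (by linarith)
  refine ⟨q * (20988 - 504 * (q * G) - (732 + q * U) + 570 * (q * (732 + q * U))) / u, ?_, ?_⟩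
  · have hG' : ‖q * G‖ ≤ 1 / 230 * (103 / 100 * 3 ^ 6) := by rw [norm_mul]; gcongr
    have hY : ‖732 + q * U‖ ≤ 732 + 1 / 230 * (103 / 100 * 4 ^ 7) := by
      refine (norm_add_le _ _).trans ?_
      rw [norm_mul, RCLike.norm_ofNat]
      gcongr
    set Y := 732 + q * U
    have hP : ‖20988 - 504 * (q * G) - Y + 570 * (q * Y)‖ ≤
        20988 + 504 * ‖q * G‖ + ‖Y‖ + 570 * (‖q‖ * ‖Y‖) := by
      refine (norm_add_le _ _).trans (add_le_add ((norm_sub_le _ _).trans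
        (add_le_add ((norm_sub_le _ _).trans (add_le_add ?_ ?_)) le_rfl)) ?_) <;> simp
    rw [norm_div, norm_mul, div_le_iff₀ (by linarith)]
    have hqY : ‖q‖ * ‖Y‖ ≤ 1 / 230 * (732 + 1 / 230 * (103 / 100 * 4 ^ 7)) := by gcongr
    have hP' : ‖20988 - 504 * (q * G) - Y + 570 * (q * Y)‖ ≤ 25500 := by
      refine hP.trans ?_
      linarith
    calc _ ≤ 1 / 230 * (25500 : ℝ) := by gcongr
      _ ≤ 160 * (697 / 1000) := by norm_num
      _ ≤ _ := by gcongr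
  · rw [eq_comm]
    field_simp
    rw [hudef]
    ring

/-- This crude bound only serves to exclude the value `-1` of `h` on the unit circle. -/
lemma equivariantFun_re_gt {z : ℂ} (hz : z ∈ halfStrip) : -1 < (equivariantFun z).re := by
  have hb := nome_im_pos hz.1 hz.2.1
  obtain ⟨W, hW, hV⟩ := exists_quotient_eq hz.2.2 hb.le
  have h1 : (Complex.I / (168 * π) * ((nome z)⁻¹ - 570 + W)).re =
      -((168 * π)⁻¹ * ((nome z)⁻¹.im + W.im)) := by
    have : Complex.I / (168 * π) = (((168 * π)⁻¹ : ℝ) : ℂ) * Complex.I := by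
      push_cast; rw [div_eq_mul_inv, mul_comm]
    rw [this, mul_assoc, Complex.re_ofReal_mul, Complex.I_mul_re]
    simp
    ring
  rw [equivariantFun, hV, Complex.add_re, h1]
  have h2 : (nome z)⁻¹.im ≤ 0 := by
    rw [Complex.inv_im]
    exact div_nonpos_of_nonpos_of_nonneg (by linarith) (Complex.normSq_nonneg _)
  have h3 : W.im ≤ 160 := (Complex.im_le_norm W).trans hW
  have hpi := Real.pi_gt_three
  have h4 : (168 * π)⁻¹ * ((nome z)⁻¹.im + W.im) < 1 := by
    rw [inv_mul_lt_iff₀ (by positivity)]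
    linarith
  linarith [hz.1]

lemma norm_equivariantFun_ge {z : ℂ} (hz : z ∈ halfStrip) :
    (Real.exp (2 * π * z.im) - 730) / 532 - z.im - 1 ≤ ‖equivariantFun z‖ := by
  have hb := nome_im_pos hz.1 hz.2.1
  obtain ⟨W, hW, hV⟩ := exists_quotient_eq hz.2.2 hb.le
  have hpi := Real.pi_lt_d2
  have hpi0 := Real.pi_pos
  have h1 : ‖(nome z)⁻¹‖ - 730 ≤ ‖(nome z)⁻¹ - 570 + W‖ := by
    have h := norm_sub_norm_le (nome z)⁻¹ (570 - W)
    have h' := norm_sub_le (570 : ℂ) W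
    rw [← sub_add] at h
    have : ‖(570 : ℂ)‖ = 570 := by simp
    linarith
  rw [norm_inv, norm_nome, Real.exp_neg, inv_inv] at h1
  have hexp : (730 : ℝ) ≤ Real.exp (2 * π * z.im) ∨ Real.exp (2 * π * z.im) < 730 := le_or_gt _ _
  have h2 : ‖z‖ ≤ z.im + 1 := by
    refine (Complex.norm_le_abs_re_add_abs_im z).trans ?_
    rw [abs_of_pos hz.1, abs_of_pos (im_pos_of_le hz.2.2)]
    linarith [hz.2.1]
  have h3 : ‖Complex.I / (168 * π) * ((nome z)⁻¹ - 570 + W)‖ =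
      ‖(nome z)⁻¹ - 570 + W‖ / (168 * π) := by
    rw [norm_mul, norm_div, Complex.norm_I, norm_mul, Complex.norm_real,
      Real.norm_of_nonneg hpi0.le, RCLike.norm_ofNat, one_div, inv_mul_eq_div]
  have h4 : (Real.exp (2 * π * z.im) - 730) / 532 ≤
      ‖Complex.I / (168 * π) * ((nome z)⁻¹ - 570 + W)‖ := by
    rw [h3]
    rcases hexp with h | h
    · exact div_le_div₀ (norm_nonneg _) h1 (by positivity) (by linarith)
    · exact (div_nonpos_of_nonpos_of_nonneg (by linarith) (by norm_num)).trans (by positivity)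
  have h5 := norm_sub_le (equivariantFun z) z
  rw [equivariantFun, hV, add_sub_cancel_left, ← hV, ← equivariantFun, hV] at h5
  linarith

/-- For real `q` the two series are real: `α = (∑ σ₅(n) qⁿ) / q` and `u = (∑ n σ₅(n) qⁿ) / q`. -/
lemma equivariantFun_im_of_nome_im_eq_zero {z : ℂ} (hz : √3 / 2 ≤ z.im) (hb : (nome z).im = 0) :
    ∃ α u : ℝ, |α - 1| ≤ 158 / 1000 ∧
      |u - (1 + 66 * (nome z).re)| ≤ 4 * |(nome z).re| ∧
      697 / 1000 ≤ u ∧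
      (equivariantFun z).im = z.im +
        (168 * π)⁻¹ * ((1 - 504 * ((nome z).re * α)) / ((nome z).re * u)) := by
  have hq := norm_nome_le hz
  have hz' := im_pos_of_le hz
  have hG := realBound_tail_A hq hb.ge
  have hU := realBound_tail_B hq hb.ge
  have hA := realBound_quadratic_add_tail_A hq hb.ge hG
  have hB := realBound_B hq hb.ge hU
  have hS0 := sigmaSeries_zero_eq hz'
  have hS1 := sigmaSeries_one_eq hz'
  have hqr : nome z = ((nome z).re : ℂ) := Complex.ext (by simp) (by simp [hb])
  set q := nome z
  set G := sigmaTail 0 3 q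
  set U := sigmaTail 1 4 q
  have hreal : ∀ {X : ℂ} {M L : ℝ}, RealBound q.im X M L → X = (X.re : ℂ) := by
    intro X M L h
    have := h.im_le
    rw [hb, mul_zero] at this
    exact Complex.ext (by simp) (by simpa using abs_nonpos_iff.mp this)
  refine ⟨1 + (33 * q + q ^ 2 * G).re, 1 + (66 * q + 732 * q ^ 2 + q ^ 3 * U).re, ?_, ?_, ?_, ?_⟩
  · rw [add_sub_cancel_left]
    exact (Complex.abs_re_le_norm _).trans hA.norm_le
  · have e : 1 + (66 * q + 732 * q ^ 2 + q ^ 3 * U).re - (1 + 66 * q.re) =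
        ((q.re : ℂ) * (732 * q + q ^ 2 * U)).re := by
      have : (66 * q + 732 * q ^ 2 + q ^ 3 * U).re = (66 * q).re +
          (q * (732 * q + q ^ 2 * U)).re := by
        rw [← Complex.add_re]; congr 1; ring
      rw [this, ← hqr]
      simp [-Complex.mul_re, Complex.mul_re 66]
    rw [e, Complex.re_ofReal_mul, abs_mul, mul_comm]
    gcongr
    refine (Complex.abs_re_le_norm _).trans ((norm_add_le _ _).trans ?_)
    rw [norm_mul, norm_mul, norm_pow, RCLike.norm_ofNat]
    calc _ ≤ 732 * (1 / 230) + (1 / 230) ^ 2 * (103 / 100 * 4 ^ 7 : ℝ) := by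
          gcongr
          exact hU.norm_le
      _ ≤ 4 := by norm_num
  · have := (abs_le.mp ((Complex.abs_re_le_norm _).trans hB.norm_le)).1
    linarith
  · have e0 : sigmaSeries 0 z = ((q.re * (1 + (33 * q + q ^ 2 * G).re) : ℝ) : ℂ) := by
      rw [hS0, add_assoc, hreal hA]; push_cast; rw [← hqr]; simp
    have e1 : sigmaSeries 1 z =
        ((q.re * (1 + (66 * q + 732 * q ^ 2 + q ^ 3 * U).re) : ℝ) : ℂ) := by
      rw [hS1, hreal hB]; push_cast; rw [← hqr]; simp
    rw [equivariantFun, Complex.add_im, e0, e1]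
    have : Complex.I / (168 * π) = (((168 * π)⁻¹ : ℝ) : ℂ) * Complex.I := by
      push_cast; rw [div_eq_mul_inv, mul_comm]
    rw [this, mul_assoc, Complex.im_ofReal_mul, Complex.I_mul_im]
    norm_cast

lemma equivariantFun_im_pos_of_re_eq_zero {z : ℂ} (hz : √3 / 2 ≤ z.im) (h0 : z.re = 0) :
    0 < (equivariantFun z).im := by
  have hi : (nome z).im = 0 := by rw [nome_im, h0]; simp
  have hr : 0 < (nome z).re := by rw [nome_re, h0]; simp [Real.exp_pos]
  have hr' : (nome z).re ≤ 1 / 230 := (Complex.re_le_norm _).trans (norm_nome_le hz)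
  obtain ⟨α, u, hα, hu, hu0, h⟩ := equivariantFun_im_of_nome_im_eq_zero hz hi
  rw [h]
  set t := (nome z).re
  rw [abs_of_pos hr] at hu
  have hα' := abs_le.mp hα
  have hu' := abs_le.mp hu
  have h1 : -400 ≤ (1 - 504 * (t * α)) / (t * u) := by
    rw [le_div_iff₀ (by positivity)]
    nlinarith
  have h3 : (1.732 : ℝ) ≤ √3 := Real.le_sqrt_of_sq_le (by norm_num)
  have hpi := Real.pi_gt_d2
  have h2 : (168 * π)⁻¹ * -400 ≤ (168 * π)⁻¹ * ((1 - 504 * (t * α)) / (t * u)) := by gcongr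
  have h4 : -0.8 ≤ (168 * π)⁻¹ * -400 := by
    rw [le_inv_mul_iff₀ (by positivity)]
    linarith
  linarith

lemma equivariantFun_im_neg_of_re_eq_half {z : ℂ} (hz : √3 / 2 ≤ z.im) (h0 : z.re = 1 / 2) :
    (equivariantFun z).im < 0 := by
  have hhalf : 2 * π * (1 / 2) = π := by ring
  have hi : (nome z).im = 0 := by rw [nome_im, h0, hhalf]; simp
  have hr : (nome z).re = -Real.exp (-(2 * π * z.im)) := by rw [nome_re, h0, hhalf]; simp
  have hr' : -(1 / 230) ≤ (nome z).re :=
    (abs_le.mp ((Complex.abs_re_le_norm _).trans (norm_nome_le hz))).1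
  obtain ⟨α, u, hα, hu, hu0, h⟩ := equivariantFun_im_of_nome_im_eq_zero hz hi
  rw [h]
  set t := Real.exp (-(2 * π * z.im)) with ht
  have ht0 : 0 < t := Real.exp_pos _
  rw [hr] at hr' hu ⊢
  rw [abs_neg, abs_of_pos ht0] at hu
  have hα' := abs_le.mp hα
  have hu' := abs_le.mp hu
  have hu1 : u ≤ 1 := by linarith
  have h1 : (1 - 504 * (-t * α)) / (-t * u) ≤ -(t⁻¹ + 424) := by
    rw [neg_mul t u, div_neg, neg_le_neg_iff, le_div_iff₀ (by positivity)]
    have : (t⁻¹ + 424) * (t * u) = u + 424 * t * u := by field_simp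
    rw [this]
    nlinarith
  have h5 := exp_five_ge
  have h3 : (1.732 : ℝ) ≤ √3 := Real.le_sqrt_of_sq_le (by norm_num)
  have hpi := Real.pi_gt_d2
  -- tangent line of `exp` at `5`
  have h6 : 84 * (2 * π * z.im) - 424 < t⁻¹ := by
    rw [ht, Real.exp_neg, inv_inv]
    have e : Real.exp (2 * π * z.im) = Real.exp 5 * Real.exp (2 * π * z.im - 5) := by
      rw [← Real.exp_add]; congr 1; ring
    have h7 := Real.add_one_le_exp (2 * π * z.im - 5)
    have h8 : (5.4 : ℝ) ≤ 2 * π * z.im := by nlinarith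
    rw [e]
    nlinarith
  have h9 : (168 * π)⁻¹ * ((1 - 504 * (-t * α)) / (-t * u)) ≤
      (168 * π)⁻¹ * -(t⁻¹ + 424) := by gcongr
  have h10 : (168 * π)⁻¹ * -(t⁻¹ + 424) < -z.im := by
    rw [inv_mul_lt_iff₀ (by positivity)]
    linarith
  linarith

/-! ### Critical points of `E₆` and the equivariant function -/

lemma E6_eq_sigmaSeries (z : ℍ) : ModularForm.E₆ z = 1 - 504 * sigmaSeries 0 z := by
  have h := EisensteinSeries.q_expansion_bernoulli (k := 6) (by norm_num) ⟨3, rfl⟩ z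
  rw [show bernoulli 6 = 1 / 42 by decide +kernel] at h
  rw [h, sigmaSeries]
  have hq : ‖nome z‖ < 1 := by simpa [nome] using norm_exp_two_pi_I_lt_one z
  rw [← tsum_zero_pnat_eq_tsum_nat (summable_coeff_mul_pow 0 hq)]
  congr 1
  have e : (2 * (6 : ℕ) / ((1 / 42 : ℚ) : ℂ)) = 504 := by norm_num
  rw [e]
  congr 1
  simp [nome]

lemma hasDerivAt_E6 (z : ℍ) :
    HasDerivAt ((ModularForm.E₆ : ℍ → ℂ) ∘ ofComplex)
      (-(504 * (2 * π * Complex.I * sigmaSeries 1 z))) (z : ℂ) := by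
  have h := ((hasDerivAt_sigmaSeries 0 z.im_pos).const_mul 504).const_sub 1
  refine h.congr_of_eventuallyEq ?_
  filter_upwards [isOpen_upperHalfPlaneSet.mem_nhds z.im_pos] with w hw
  rw [Function.comp_apply, E6_eq_sigmaSeries, ofComplex_apply_of_im_pos hw]

lemma isCriticalPointE6_iff_sigmaSeries (z : ℍ) :
    IsCriticalPointE6 z ↔ sigmaSeries 1 z = 0 := by
  have h := hasDerivAt_E6 z
  have hpi : (π : ℂ) ≠ 0 := Complex.ofReal_ne_zero.mpr Real.pi_ne_zero
  constructor
  · intro h0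
    have := h0.unique h
    simpa [hpi, eq_comm] using this
  · intro h0
    rw [h0] at h
    simpa [IsCriticalPointE6] using h

lemma E6_slash (γ : SL(2, ℤ)) : (ModularForm.E₆ : ℍ → ℂ) ∣[(6 : ℤ)] γ = ModularForm.E₆ :=
  ModularForm.E₆.slash_action_eq' _ ⟨γ, rfl⟩

lemma E6_smul (γ : SL(2, ℤ)) (z : ℍ) :
    ModularForm.E₆ (γ • z) = denom γ z ^ 6 * ModularForm.E₆ z := by
  have h := congrFun (E6_slash γ) z
  rw [ModularForm.SL_slash_apply] at h
  have hd := denom_ne_zero γ z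
  rw [← h, zpow_neg, mul_comm, mul_assoc]
  norm_cast
  rw [inv_mul_cancel₀ (pow_ne_zero 6 hd), mul_one]

/-- The transformation law of `E₆'`, in terms of `∑ n σ₅(n) qⁿ = -E₆' / (1008 π i)`. -/
lemma sigmaSeries_one_smul (γ : SL(2, ℤ)) (z : ℍ) :
    sigmaSeries 1 (γ • z : ℍ) = denom γ z ^ 7 *
      (denom γ z * sigmaSeries 1 z + Complex.I / (168 * π) * (γ 1 0 : ℂ) * ModularForm.E₆ z) := by
  have hD : ∀ w : ℍ, Derivative.normalizedDerivOfComplex ModularForm.E₆ w =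
      -504 * sigmaSeries 1 w := by
    intro w
    rw [Derivative.normalizedDerivOfComplex, (hasDerivAt_E6 w).deriv]
    have hpi : (π : ℂ) ≠ 0 := Complex.ofReal_ne_zero.mpr Real.pi_ne_zero
    field_simp [Complex.I_ne_zero]
  have h := congrFun (Derivative.normalizedDerivOfComplex_SL_slash (k := 6) (γ := γ)
    (F := ModularForm.E₆) (ModularFormClass.holo ModularForm.E₆)) z
  rw [Pi.sub_apply, E6_slash, ModularForm.SL_slash_apply, hD, hD] at h
  have hd := denom_ne_zero γ z
  have hpi : (π : ℂ) ≠ 0 := Complex.ofReal_ne_zero.mpr Real.pi_ne_zero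
  rw [show -((6 : ℤ) + 2) = -(8 : ℕ) by norm_num, zpow_neg, zpow_natCast] at h
  have e : (2 * π * Complex.I : ℂ)⁻¹ = -(Complex.I / (2 * π)) := by
    rw [mul_inv, Complex.inv_I]; field_simp
  rw [e] at h
  push_cast at h
  generalize denom γ z = D at *
  field_simp at h
  field_simp
  linear_combination (1 / 6 : ℂ) * h

/-- For `Im z ≥ √3 / 2` the point `γ z` is critical if and only if `h(z) = -d / c`. -/
lemma isCriticalPointE6_smul_iff (γ : SL(2, ℤ)) (z : ℍ) (hz : √3 / 2 ≤ z.im) :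
    IsCriticalPointE6 (γ • z) ↔ (γ 1 0 : ℂ) * equivariantFun z + (γ 1 1 : ℂ) = 0 := by
  have hne : sigmaSeries 1 z ≠ 0 := sigmaSeries_one_ne_zero (by simpa using hz)
  have hd := denom_ne_zero γ z
  rw [isCriticalPointE6_iff_sigmaSeries, sigmaSeries_one_smul,
    mul_eq_zero_iff_left (pow_ne_zero _ hd), ModularGroup.denom_apply, E6_eq_sigmaSeries]
  have : ((γ 1 0 : ℂ) * z + (γ 1 1 : ℂ)) * sigmaSeries 1 z +
      Complex.I / (168 * π) * (γ 1 0 : ℂ) * (1 - 504 * sigmaSeries 0 z) =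
      ((γ 1 0 : ℂ) * equivariantFun z + (γ 1 1 : ℂ)) * sigmaSeries 1 z := by
    rw [equivariantFun]
    field_simp
    ring
  rw [this, mul_eq_zero_iff_right hne]

/-- The equivariant function maps the unit circle to itself: there `-1 / z = -conj z`, so that the
equivariance `h(-1 / z) = -1 / h(z)` and the reflection `h(-conj z) = -conj (h(z))` combine to
`h(z) conj(h(z)) = 1`. -/
lemma norm_equivariantFun_of_norm_eq_one {z : ℂ} (hz : √3 / 2 ≤ z.im) (h1 : ‖z‖ = 1) :
    ‖equivariantFun z‖ = 1 := by
  set τ : ℍ := ⟨z, im_pos_of_le hz⟩ with hτ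
  have hzz : z * conj z = 1 := by rw [Complex.mul_conj, ← Complex.sq_norm, h1]; simp
  have hz0 : z ≠ 0 := left_ne_zero_of_mul_eq_one hzz
  have hcz : conj z = z⁻¹ := eq_inv_of_mul_eq_one_right hzz
  have hS : ((ModularGroup.S • τ : ℍ) : ℂ) = -conj z := by
    rw [UpperHalfPlane.modular_S_smul, hcz, ← inv_neg]
  have hden : denom (ModularGroup.S : SL(2, ℤ)) τ = z := by
    rw [ModularGroup.denom_apply]
    simp [hτ, ModularGroup.S]
  have hE : conj (1 - 504 * sigmaSeries 0 z) = z ^ 6 * (1 - 504 * sigmaSeries 0 z) := by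
    have := E6_smul ModularGroup.S τ
    rw [E6_eq_sigmaSeries, E6_eq_sigmaSeries, hS, hden,
      sigmaSeries_eq_conj 0 (nome_neg_conj z)] at this
    simpa [hτ, Complex.conj_ofNat] using this
  have hB : conj (sigmaSeries 1 z) = z ^ 7 * (z * sigmaSeries 1 z +
      Complex.I / (168 * π) * (1 - 504 * sigmaSeries 0 z)) := by
    have := sigmaSeries_one_smul ModularGroup.S τ
    rw [E6_eq_sigmaSeries, hS, hden, sigmaSeries_eq_conj 1 (nome_neg_conj z)] at this
    simpa [hτ, ModularGroup.S] using this
  have hne := sigmaSeries_one_ne_zero hz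
  have hne' : conj (sigmaSeries 1 z) ≠ 0 := (map_ne_zero _).mpr hne
  have hconj : conj (equivariantFun z) = conj z - Complex.I / (168 * π) *
      (conj (1 - 504 * sigmaSeries 0 z) / conj (sigmaSeries 1 z)) := by
    rw [equivariantFun, map_add, map_mul, map_div₀, map_div₀, Complex.conj_I, map_mul,
      Complex.conj_ofReal, Complex.conj_ofNat]
    ring
  have key : equivariantFun z * conj (equivariantFun z) = 1 := by
    rw [hB] at hne'
    have hX := right_ne_zero_of_mul hne'
    rw [hconj, hE, hB, hcz, equivariantFun]
    set k := Complex.I / (168 * π)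
    set e := 1 - 504 * sigmaSeries 0 z
    set s := sigmaSeries 1 z
    field_simp
    ring
  rw [Complex.mul_conj, ← Complex.sq_norm] at key
  have : ‖equivariantFun z‖ ^ 2 = 1 := by exact_mod_cast key
  nlinarith [norm_nonneg (equivariantFun z)]

/-! ### The curve where the equivariant function is real -/

lemma continuousAt_im_equivariantFun {x y : ℝ} (hy : √3 / 2 ≤ y) :
    ContinuousAt (fun y : ℝ => (equivariantFun (x + y * Complex.I)).im) y := by
  have h1 : ContinuousAt (fun y : ℝ => (x : ℂ) + y * Complex.I) y := by fun_prop
  have h2 : ContinuousAt equivariantFun (x + y * Complex.I) :=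
    continuousAt_equivariantFun (by simpa using hy)
  exact Complex.continuous_im.continuousAt.comp
    (h2.comp (f := fun y : ℝ => (x : ℂ) + y * Complex.I) h1)

lemma exists_im_equivariantFun_eq_zero {y : ℝ} (hy : √3 / 2 ≤ y) :
    ∃ x ∈ Set.Ioo (0 : ℝ) (1 / 2), (equivariantFun (x + y * Complex.I)).im = 0 := by
  have hc : ContinuousOn (fun x : ℝ => (equivariantFun (x + y * Complex.I)).im)
      (Set.Icc 0 (1 / 2)) := by
    intro x _
    have h1 : ContinuousAt (fun x : ℝ => (x : ℂ) + y * Complex.I) x := by fun_prop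
    have h2 : ContinuousAt equivariantFun (x + y * Complex.I) :=
      continuousAt_equivariantFun (by simpa using hy)
    exact (Complex.continuous_im.continuousAt.comp
      (h2.comp (f := fun x : ℝ => (x : ℂ) + y * Complex.I) h1)).continuousWithinAt
  have h0 : 0 < (equivariantFun ((0 : ℝ) + y * Complex.I)).im :=
    equivariantFun_im_pos_of_re_eq_zero (by simpa using hy) (by simp)
  have h1 : (equivariantFun ((1 / 2 : ℝ) + y * Complex.I)).im < 0 :=
    equivariantFun_im_neg_of_re_eq_half (by simpa using hy) (by simp)
  obtain ⟨x, hx, hx0⟩ := intermediate_value_Ioo' (by norm_num) hc ⟨h1, h0⟩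
  exact ⟨x, hx, hx0⟩

/-- The real locus of `h` in the half strip is the graph over the imaginary axis of a continuous
function. -/
lemma exists_continuousOn_real_locus : ∃ X : ℝ → ℝ, ContinuousOn X (Set.Ici (√3 / 2)) ∧
    ∀ y, √3 / 2 ≤ y → X y ∈ Set.Ioo (0 : ℝ) (1 / 2) ∧
      (equivariantFun (X y + y * Complex.I)).im = 0 ∧
      ∀ x ∈ Set.Icc (0 : ℝ) (1 / 2), (equivariantFun (x + y * Complex.I)).im = 0 → x = X y := by
  have hex : ∀ y : ℝ, ∃ x : ℝ, √3 / 2 ≤ y → x ∈ Set.Ioo (0 : ℝ) (1 / 2) ∧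
      (equivariantFun (x + y * Complex.I)).im = 0 := by
    intro y
    by_cases hy : √3 / 2 ≤ y
    · obtain ⟨x, hx, h⟩ := exists_im_equivariantFun_eq_zero hy
      exact ⟨x, fun _ => ⟨hx, h⟩⟩
    · exact ⟨0, fun h => absurd h hy⟩
  choose X hX using hex
  refine ⟨X, ?_, fun y hy => ⟨(hX y hy).1, (hX y hy).2, fun x hx h =>
    (strictAntiOn_im_equivariantFun hy).injOn hx (Set.Ioo_subset_Icc_self (hX y hy).1)
      (h.trans (hX y hy).2.symm)⟩⟩
  intro y hy
  have hXy := (hX y hy).1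
  refine tendsto_order.mpr ⟨fun l hl => ?_, fun l hl => ?_⟩
  · rcases lt_or_ge l 0 with h0 | h0
    · filter_upwards [self_mem_nhdsWithin] with y' hy'
      exact h0.trans (hX y' hy').1.1
    · have hl' : l ∈ Set.Icc (0 : ℝ) (1 / 2) := ⟨h0, (hl.trans hXy.2).le⟩
      have hpos : 0 < (equivariantFun (l + y * Complex.I)).im := by
        rw [← (hX y hy).2]
        exact strictAntiOn_im_equivariantFun hy hl' (Set.Ioo_subset_Icc_self hXy) hl
      filter_upwards [((continuousAt_im_equivariantFun hy).eventually
        (lt_mem_nhds hpos)).filter_mono nhdsWithin_le_nhds, self_mem_nhdsWithin] with y' h1 hy'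
      rw [← (hX y' hy').2] at h1
      exact ((strictAntiOn_im_equivariantFun hy').lt_iff_gt
        (Set.Ioo_subset_Icc_self (hX y' hy').1) hl').mp h1
  · rcases lt_or_ge (1 / 2) l with h0 | h0
    · filter_upwards [self_mem_nhdsWithin] with y' hy'
      exact (hX y' hy').1.2.trans h0
    · have hl' : l ∈ Set.Icc (0 : ℝ) (1 / 2) := ⟨(hXy.1.trans hl).le, h0⟩
      have hneg : (equivariantFun (l + y * Complex.I)).im < 0 := by
        rw [← (hX y hy).2]
        exact strictAntiOn_im_equivariantFun hy (Set.Ioo_subset_Icc_self hXy) hl' hl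
      filter_upwards [((continuousAt_im_equivariantFun hy).eventually
        (gt_mem_nhds hneg)).filter_mono nhdsWithin_le_nhds, self_mem_nhdsWithin] with y' h1 hy'
      rw [← (hX y' hy').2] at h1
      exact ((strictAntiOn_im_equivariantFun hy').lt_iff_gt hl'
        (Set.Ioo_subset_Icc_self (hX y' hy').1)).mp h1

/-- A parametrization `y ↦ p y` of the real locus of `h` in the half strip by the imaginary part,
together with the height `y₀` at which it leaves the unit disc. -/
lemma exists_real_curve : ∃ (p : ℝ → ℂ) (g : ℝ → ℝ) (y₀ : ℝ), √3 / 2 ≤ y₀ ∧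
    (∀ y, √3 / 2 ≤ y → p y ∈ halfStrip ∧ equivariantFun (p y) = g y) ∧
    (∀ z ∈ halfStrip, (equivariantFun z).im = 0 → z = p z.im) ∧
    StrictMonoOn g (Set.Ici (√3 / 2)) ∧ g y₀ = 1 ∧ ‖p y₀‖ = 1 ∧
    (∀ y, √3 / 2 ≤ y → (1 ≤ ‖p y‖ ↔ y₀ ≤ y)) ∧
    (∀ r, 1 ≤ r → ∃ y, y₀ ≤ y ∧ g y = r) := by
  obtain ⟨X, hXc, hX⟩ := exists_continuousOn_real_locus
  set a := √3 / 2 with ha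
  have ha0 : 0 < a := by positivity
  have ha2 : a ^ 2 = 3 / 4 := by rw [ha, div_pow, Real.sq_sqrt (by norm_num)]; norm_num
  have ha1 : a ≤ 1 := by nlinarith
  set p : ℝ → ℂ := fun y => X y + y * Complex.I with hp
  set g : ℝ → ℝ := fun y => (equivariantFun (p y)).re with hg
  have hpre : ∀ y, (p y).re = X y := fun y => by simp [hp]
  have hpim : ∀ y, (p y).im = y := fun y => by simp [hp]
  have hmem : ∀ y, a ≤ y → p y ∈ halfStrip := fun y hy =>
    ⟨by rw [hpre]; exact (hX y hy).1.1, by rw [hpre]; exact (hX y hy).1.2, by rwa [hpim]⟩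
  have hval : ∀ y, a ≤ y → equivariantFun (p y) = g y := fun y hy =>
    Complex.ext (by simp [hg]) (by simpa using (hX y hy).2.1)
  have hpc : ContinuousOn p (Set.Ici a) := by
    have h1 : ContinuousOn (fun y => (X y : ℂ)) (Set.Ici a) :=
      Complex.continuous_ofReal.comp_continuousOn hXc
    have h2 : Continuous (fun y : ℝ => (y : ℂ) * Complex.I) := by fun_prop
    exact h1.add h2.continuousOn
  have hgc : ContinuousOn g (Set.Ici a) := by
    intro y hy
    exact Complex.continuous_re.continuousAt.comp_continuousWithinAt
      ((continuousAt_equivariantFun (hmem y hy).2.2).comp_continuousWithinAt (hpc y hy))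
  have hnc : ContinuousOn (fun y => ‖p y‖) (Set.Ici a) := hpc.norm
  have hginj : Set.InjOn g (Set.Ici a) := by
    intro y hy y' hy' h
    have h1 : equivariantFun (p y) = equivariantFun (p y') := by
      rw [hval y hy, hval y' hy', h]
    have := congrArg Complex.im (injOn_equivariantFun (hmem y hy) (hmem y' hy') h1)
    rwa [hpim, hpim] at this
  have hggt : ∀ y, a ≤ y → -1 < g y := fun y hy => equivariantFun_re_gt (hmem y hy)
  have hunb : ∀ r : ℝ, ∃ Y₀, a ≤ Y₀ ∧ ∀ Y, Y₀ ≤ Y → r < g Y := by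
    intro r
    refine ⟨|r| + 100, by linarith [abs_nonneg r], fun Y hY => ?_⟩
    have hr := abs_nonneg r
    have hYa : a ≤ Y := by linarith
    have h1 := norm_equivariantFun_ge (hmem Y hYa)
    rw [hval Y hYa, hpim, Complex.norm_real, Real.norm_eq_abs] at h1
    have h2 := Real.quadratic_le_exp_of_nonneg (x := 2 * π * Y)
      (by have := Real.pi_pos; have : 0 ≤ Y := by linarith
          positivity)
    have h3 : (6 * Y) ^ 2 ≤ (2 * π * Y) ^ 2 := by
      have := Real.pi_gt_three
      have : 0 ≤ Y := by linarith
      gcongr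
      linarith
    have h4 : 0 < 2 * π * Y := by
      have := Real.pi_pos
      have : 0 < Y := by linarith
      positivity
    have h5 : |r| + 1 < |g Y| := by
      have h6 : 18 * Y ^ 2 ≤ Real.exp (2 * π * Y) := by nlinarith
      have h7 : |r| + 1 + Y + 1 < (18 * Y ^ 2 - 730) / 532 := by
        rw [lt_div_iff₀ (by norm_num)]
        nlinarith
      have h8 : (18 * Y ^ 2 - 730) / 532 ≤ (Real.exp (2 * π * Y) - 730) / 532 := by gcongr
      linarith
    rcases lt_abs.mp h5 with h | h
    · linarith [le_abs_self r]
    · linarith [hggt Y hYa]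
  have hmono : StrictMonoOn g (Set.Ici a) := by
    intro y hy y' hy' hlt
    obtain ⟨Y₀, -, hY⟩ := hunb (g a)
    have hY1 := hY (max Y₀ (y' + 1)) (le_max_left _ _)
    set Y := max Y₀ (y' + 1)
    have hYy : y' < Y := lt_of_lt_of_le (by linarith) (le_max_right _ _)
    have hy0 : a ≤ y := hy
    have haY : a ≤ Y := by linarith
    rcases ContinuousOn.strictMonoOn_of_injOn_Icc' haY (hgc.mono Set.Icc_subset_Ici_self)
      (hginj.mono Set.Icc_subset_Ici_self) with h | h
    · exact h ⟨hy0, by linarith⟩ ⟨hy', hYy.le⟩ hlt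
    · have := h ⟨le_rfl, haY⟩ ⟨haY, le_rfl⟩ (by linarith)
      exact absurd hY1 this.not_gt
  have hnsq : ∀ y, ‖p y‖ ^ 2 = X y ^ 2 + y ^ 2 := by
    intro y
    rw [Complex.sq_norm, Complex.normSq_apply, hpre, hpim]; ring
  have hna : ‖p a‖ < 1 := by
    have h1 := hnsq a
    have h2 := (hX a le_rfl).1
    have : X a ^ 2 < 1 / 4 := by nlinarith [h2.1, h2.2]
    nlinarith [norm_nonneg (p a)]
  have hn1 : ∀ y, 1 ≤ y → 1 < ‖p y‖ := by
    intro y hy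
    have h1 := hnsq y
    have h2 := (hX y (by linarith)).1.1
    have : 0 < X y ^ 2 := by positivity
    by_contra h
    nlinarith [norm_nonneg (p y)]
  -- `h` preserves the unit circle and `-1` is excluded
  have hcross : ∀ y, a ≤ y → ‖p y‖ = 1 → g y = 1 := by
    intro y hy h
    have h1 := norm_equivariantFun_of_norm_eq_one (hmem y hy).2.2 h
    rw [hval y hy, Complex.norm_real, Real.norm_eq_abs] at h1
    rcases (abs_eq (by norm_num)).mp h1 with h2 | h2
    · exact h2
    · exact absurd (hggt y hy) (by rw [h2]; exact lt_irrefl _)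
  obtain ⟨y₀, hy₀, hy₀1⟩ := intermediate_value_Icc ha1 (hnc.mono Set.Icc_subset_Ici_self)
    ⟨hna.le, (hn1 1 le_rfl).le⟩
  have hg₀ := hcross y₀ hy₀.1 hy₀1
  have huniq : ∀ y, a ≤ y → ‖p y‖ = 1 → y = y₀ := fun y hy h =>
    hginj hy hy₀.1 ((hcross y hy h).trans hg₀.symm)
  have hiff : ∀ y, a ≤ y → (1 ≤ ‖p y‖ ↔ y₀ ≤ y) := by
    intro y hy
    constructor
    · intro h
      by_contra! hlt
      obtain ⟨w, hw, hw1⟩ := intermediate_value_Icc hy (hnc.mono Set.Icc_subset_Ici_self)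
        ⟨hna.le, h⟩
      have := huniq w hw.1 hw1
      linarith [hw.2]
    · intro h
      by_contra! hlt
      have hy1 : y ≤ 1 := by
        by_contra! h'
        exact absurd (hn1 y h'.le) hlt.not_gt
      obtain ⟨w, hw, hw1⟩ := intermediate_value_Icc hy1
        (hnc.mono (Set.Icc_subset_Ici_self.trans (Set.Ici_subset_Ici.mpr hy)))
        ⟨hlt.le, (hn1 1 le_rfl).le⟩
      have hw0 := huniq w (hy.trans hw.1) hw1
      have : y = y₀ := le_antisymm (hw0 ▸ hw.1) h
      rw [this] at hlt
      exact absurd hy₀1 hlt.ne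
  refine ⟨p, g, y₀, hy₀.1, fun y hy => ⟨hmem y hy, hval y hy⟩, ?_, hmono, hg₀, hy₀1, hiff, ?_⟩
  · intro z hz h
    have h1 := (hX z.im hz.2.2).2.2 z.re ⟨hz.1.le, hz.2.1.le⟩ (by rw [Complex.re_add_im]; exact h)
    rw [hp]
    simp only
    rw [← h1, Complex.re_add_im]
  · intro r hr
    obtain ⟨Y₀, hY₀, hY⟩ := hunb r
    set Y := max Y₀ y₀
    obtain ⟨y, hy, hyr⟩ := intermediate_value_Icc (le_max_right Y₀ y₀)
      (hgc.mono (Set.Icc_subset_Ici_self.trans (Set.Ici_subset_Ici.mpr hy₀.1)))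
      ⟨hg₀.trans_le hr, (hY Y (le_max_left _ _)).le⟩
    exact ⟨y, hy.1, hyr⟩

/-! ### Real values on the fundamental domain -/

/-- The left half `0 ≤ Re z ≤ 1 / 2`, `‖z‖ ≥ 1` of the fundamental domain. -/
def leftHalf : Set ℂ := {z | 0 ≤ z.re ∧ z.re ≤ 1 / 2 ∧ 1 ≤ ‖z‖ ∧ 0 < z.im}

lemma im_ge_of_mem_leftHalf {z : ℂ} (hz : z ∈ leftHalf) : √3 / 2 ≤ z.im := by
  obtain ⟨h0, h1, h2, h3⟩ := hz
  have h4 : ‖z‖ ^ 2 = z.re ^ 2 + z.im ^ 2 := by rw [Complex.sq_norm, Complex.normSq_apply]; ring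
  have h5 : 3 / 4 ≤ z.im ^ 2 := by nlinarith
  have h6 : (√3 / 2) ^ 2 = 3 / 4 := by rw [div_pow, Real.sq_sqrt (by norm_num)]; norm_num
  exact (pow_le_pow_iff_left₀ (by positivity) h3.le two_ne_zero).mp (h6.trans_le h5)

lemma mem_halfStrip_of_mem_leftHalf {z : ℂ} (hz : z ∈ leftHalf) {r : ℝ}
    (h : equivariantFun z = r) : z ∈ halfStrip := by
  have hy := im_ge_of_mem_leftHalf hz
  have him : (equivariantFun z).im = 0 := by rw [h]; simp
  refine ⟨lt_of_le_of_ne hz.1 fun h0 => ?_, lt_of_le_of_ne hz.2.1 fun h0 => ?_, hy⟩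
  · exact (equivariantFun_im_pos_of_re_eq_zero hy h0.symm).ne' him
  · exact (equivariantFun_im_neg_of_re_eq_half hy h0).ne him

lemma one_le_of_mem_leftHalf {z : ℂ} (hz : z ∈ leftHalf) {r : ℝ} (h : equivariantFun z = r) :
    1 ≤ r ∧ (‖z‖ = 1 ↔ r = 1) := by
  have hs := mem_halfStrip_of_mem_leftHalf hz h
  obtain ⟨p, g, y₀, hy₀, hp, hpu, hmono, hg₀, hp₀, hiff, -⟩ := exists_real_curve
  have hzp := hpu z hs (by rw [h]; simp)
  have hgz : g z.im = r := by
    have := (hp z.im hs.2.2).2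
    rw [← hzp, h] at this
    exact_mod_cast this.symm
  have hle : y₀ ≤ z.im := (hiff z.im hs.2.2).mp (hzp ▸ hz.2.2.1)
  refine ⟨?_, ?_, ?_⟩
  · rw [← hg₀, ← hgz]
    exact hmono.monotoneOn hy₀ hs.2.2 hle
  · intro h1
    have := norm_equivariantFun_of_norm_eq_one hs.2.2 h1
    have h2 := equivariantFun_re_gt hs
    rw [h, Complex.norm_real, Real.norm_eq_abs] at this
    rw [h, Complex.ofReal_re] at h2
    rcases (abs_eq (by norm_num)).mp this with h3 | h3
    · exact h3
    · linarith
  · intro h1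
    have : z.im = y₀ := hmono.injOn hs.2.2 hy₀ (by rw [hgz, hg₀, h1])
    rw [hzp, this, hp₀]

lemma exists_mem_leftHalf {r : ℝ} (hr : 1 ≤ r) : ∃ z ∈ leftHalf, equivariantFun z = r := by
  obtain ⟨p, g, y₀, hy₀, hp, -, -, -, -, hiff, hsurj⟩ := exists_real_curve
  obtain ⟨y, hy, rfl⟩ := hsurj r hr
  have hy' := hy₀.trans hy
  have hm := (hp y hy').1
  exact ⟨p y, ⟨hm.1.le, hm.2.1.le, (hiff y hy').mpr hy, im_pos_of_le hm.2.2⟩, (hp y hy').2⟩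

lemma norm_lt_norm_sub_one_iff (z : ℂ) : ‖z‖ < ‖z - 1‖ ↔ z.re < 1 / 2 := by
  rw [← sq_lt_sq₀ (norm_nonneg _) (norm_nonneg _), Complex.sq_norm, Complex.sq_norm,
    Complex.normSq_apply, Complex.normSq_apply]
  simp only [Complex.sub_re, Complex.one_re, Complex.sub_im, Complex.one_im]
  constructor <;> intro h <;> linarith

lemma norm_sub_one_lt_norm_iff (z : ℂ) : ‖z - 1‖ < ‖z‖ ↔ 1 / 2 < z.re := by
  rw [← sq_lt_sq₀ (norm_nonneg _) (norm_nonneg _), Complex.sq_norm, Complex.sq_norm,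
    Complex.normSq_apply, Complex.normSq_apply]
  simp only [Complex.sub_re, Complex.one_re, Complex.sub_im, Complex.one_im]
  constructor <;> intro h <;> linarith

/-! ### The boundary of the fundamental domain -/

lemma notMem_frontier_basicDomain {τ : ℍ} (h0 : 0 < τ.re) (h1 : τ.re < 1)
    (h2 : 1 < ‖(τ : ℂ)‖) (h3 : 1 < ‖(τ : ℂ) - 1‖) : τ ∉ frontier basicDomain := by
  have hc : Continuous fun τ : ℍ => (τ : ℂ) := continuous_coe
  have ho : IsOpen ({τ : ℍ | 0 < τ.re} ∩ ({τ : ℍ | τ.re < 1} ∩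
      ({τ : ℍ | 1 < ‖(τ : ℂ)‖} ∩ {τ : ℍ | 1 < ‖(τ : ℂ) - 1‖}))) :=
    (isOpen_lt continuous_const UpperHalfPlane.continuous_re).inter
    ((isOpen_lt UpperHalfPlane.continuous_re continuous_const).inter
    ((isOpen_lt continuous_const hc.norm).inter
    (isOpen_lt continuous_const (hc.sub continuous_const).norm)))
  have hi : τ ∈ interior basicDomain := by
    refine mem_interior.mpr ⟨_, fun w hw => ?_, ho, ⟨h0, h1, h2, h3⟩⟩
    exact ⟨hw.1.le, hw.2.1.le, hw.2.2.1.le, hw.2.2.2.le⟩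
  exact fun h => h.2 hi

/-- A point of the domain on a unit circle with real centre `x`, whose open disc the domain avoids,
is a boundary point: move it radially towards the centre. -/
lemma mem_frontier_basicDomain {τ : ℍ} (x : ℝ) (hτ : τ ∈ basicDomain)
    (hx : ∀ w ∈ basicDomain, 1 ≤ ‖(w : ℂ) - x‖) (h1 : ‖(τ : ℂ) - x‖ = 1) :
    τ ∈ frontier basicDomain := by
  refine ⟨subset_closure hτ, fun hi => ?_⟩
  have e1 : (x : ℂ) + ((1 : ℝ) : ℂ) * ((τ : ℂ) - x) = τ := by push_cast; ring
  have hc : ContinuousAt (fun s : ℝ => ofComplex (x + (s : ℂ) * ((τ : ℂ) - x))) 1 := by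
    have h2 : ContinuousAt (fun s : ℝ => (x : ℂ) + (s : ℂ) * ((τ : ℂ) - x)) 1 := by fun_prop
    have h3 : ContinuousAt ofComplex ((x : ℂ) + ((1 : ℝ) : ℂ) * ((τ : ℂ) - x)) := by
      rw [e1]
      exact (contMDiffAt_ofComplex (n := 0) τ.im_pos).continuousAt
    exact h3.comp (f := fun s : ℝ => (x : ℂ) + (s : ℂ) * ((τ : ℂ) - x)) h2
  have hmem : basicDomain ∈ nhds (ofComplex ((x : ℂ) + ((1 : ℝ) : ℂ) * ((τ : ℂ) - x))) := by
    rw [e1, ofComplex_apply]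
    exact mem_interior_iff_mem_nhds.mp hi
  have hev := (hc.eventually hmem).filter_mono (nhdsWithin_le_nhds (s := Set.Iio 1))
  have hev' : ∀ᶠ s : ℝ in nhdsWithin 1 (Set.Iio 1), 0 < s :=
    (lt_mem_nhds one_pos).filter_mono nhdsWithin_le_nhds
  obtain ⟨s, ⟨hs, hs0⟩, hs1⟩ := ((hev.and hev').and self_mem_nhdsWithin).exists
  have him : 0 < ((x : ℂ) + (s : ℂ) * ((τ : ℂ) - x)).im := by
    simp only [Complex.add_im, Complex.ofReal_im, Complex.im_ofReal_mul, Complex.sub_im, coe_im]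
    have := τ.im_pos
    simpa using mul_pos hs0 this
  have h4 := hx _ hs
  rw [ofComplex_apply_of_im_pos him] at h4
  simp only at h4
  rw [add_sub_cancel_left, norm_mul, h1, mul_one, Complex.norm_real,
    Real.norm_of_nonneg hs0.le] at h4
  exact absurd hs1 (not_lt.mpr h4)

/-! ### Counting critical points in a translate of the fundamental domain -/

lemma mem_leftHalf_or {τ : ℍ} (hτ : τ ∈ basicDomain) :
    (τ : ℂ) ∈ leftHalf ∨ 1 - conj (τ : ℂ) ∈ leftHalf := by
  obtain ⟨h0, h1, h2, h3⟩ := hτ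
  rcases le_total τ.re (1 / 2) with h | h
  · exact Or.inl ⟨h0, h, h2, τ.im_pos⟩
  · refine Or.inr ⟨by simpa using h1, ?_, ?_, by simpa using τ.im_pos⟩
    · simp; linarith
    · rw [← RCLike.norm_conj, map_sub, map_one, Complex.conj_conj, norm_sub_rev]
      exact h3

lemma im_ge_of_mem_basicDomain {τ : ℍ} (hτ : τ ∈ basicDomain) : √3 / 2 ≤ (τ : ℂ).im := by
  rcases mem_leftHalf_or hτ with h | h
  · exact im_ge_of_mem_leftHalf h
  · simpa using im_ge_of_mem_leftHalf h

/-- The reflection `z ↦ 1 - conj z` of the upper half plane. -/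
noncomputable def reflect (τ : ℍ) : ℍ := ⟨1 - conj (τ : ℂ), by simpa using τ.im_pos⟩

lemma reflect_mem_basicDomain {τ : ℍ} (hτ : τ ∈ basicDomain) : reflect τ ∈ basicDomain := by
  obtain ⟨h0, h1, h2, h3⟩ := hτ
  have e : (reflect τ).re = 1 - τ.re := by simp [reflect, ← coe_re]
  refine ⟨by rw [e]; linarith, by rw [e]; linarith, ?_, ?_⟩
  · rw [reflect, coe_mk, ← RCLike.norm_conj, map_sub, map_one, Complex.conj_conj, norm_sub_rev]
    exact h3
  · have : 1 - conj (τ : ℂ) - 1 = -conj (τ : ℂ) := by ring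
    rw [reflect, coe_mk, this, norm_neg, RCLike.norm_conj]
    exact h2

lemma mem_basicDomain_of_mem_leftHalf {z : ℂ} (hz : z ∈ leftHalf) :
    (⟨z, hz.2.2.2⟩ : ℍ) ∈ basicDomain := by
  obtain ⟨h0, h1, h2, h3⟩ := hz
  exact ⟨h0, h1.trans (by norm_num), h2, h2.trans
    (not_lt.mp fun h => absurd ((norm_sub_one_lt_norm_iff z).mp h) h1.not_gt)⟩

lemma mem_frontier_iff_of_mem_halfStrip {τ : ℍ} (hτ : τ ∈ basicDomain)
    (hs : (τ : ℂ) ∈ halfStrip) : τ ∈ frontier basicDomain ↔ ‖(τ : ℂ)‖ = 1 := by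
  constructor
  · intro h
    by_contra hne
    have h1 : 1 < ‖(τ : ℂ)‖ := lt_of_le_of_ne hτ.2.2.1 (Ne.symm hne)
    exact notMem_frontier_basicDomain hs.1 (lt_trans hs.2.1 (by norm_num)) h1
      (h1.trans ((norm_lt_norm_sub_one_iff _).mpr hs.2.1)) h
  · intro h
    exact mem_frontier_basicDomain 0 hτ (fun w hw => by simpa using hw.2.2.1) (by simpa using h)

lemma mem_frontier_iff_of_reflect_mem_halfStrip {τ : ℍ} (hτ : τ ∈ basicDomain)
    (hs : 1 - conj (τ : ℂ) ∈ halfStrip) :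
    τ ∈ frontier basicDomain ↔ ‖1 - conj (τ : ℂ)‖ = 1 := by
  have e : ‖1 - conj (τ : ℂ)‖ = ‖(τ : ℂ) - 1‖ := by
    rw [← RCLike.norm_conj, map_sub, map_one, Complex.conj_conj, norm_sub_rev]
  rw [e]
  constructor
  · intro h
    by_contra hne
    have h1 : 1 < ‖(τ : ℂ) - 1‖ := lt_of_le_of_ne hτ.2.2.2 (Ne.symm hne)
    have h2 : 1 / 2 < τ.re := by
      have := hs.2.1
      simp at this
      linarith
    have h3 : τ.re < 1 := by simpa using hs.1
    exact notMem_frontier_basicDomain (by linarith) h3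
      (h1.trans ((norm_sub_one_lt_norm_iff _).mpr h2)) h1 h
  · intro h
    exact mem_frontier_basicDomain 1 hτ (fun w hw => by simpa using hw.2.2.2) (by simpa using h)

/-- A real value `r` of `h` on the fundamental domain satisfies `r ≥ 1` on the left half and
`r ≤ 0` on the right half, with equality exactly on the boundary. -/
lemma real_value_on_basicDomain {τ : ℍ} (hτ : τ ∈ basicDomain) {r : ℝ}
    (h : equivariantFun τ = r) :
    (1 ≤ r ∧ (τ : ℂ) ∈ halfStrip ∧ (τ ∈ frontier basicDomain ↔ r = 1)) ∨
    (r ≤ 0 ∧ 1 - conj (τ : ℂ) ∈ halfStrip ∧ (τ ∈ frontier basicDomain ↔ r = 0)) := by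
  rcases mem_leftHalf_or hτ with hl | hl
  · have hs := mem_halfStrip_of_mem_leftHalf hl h
    obtain ⟨h1, h2⟩ := one_le_of_mem_leftHalf hl h
    exact Or.inl ⟨h1, hs, (mem_frontier_iff_of_mem_halfStrip hτ hs).trans h2⟩
  · have h' : equivariantFun (1 - conj (τ : ℂ)) = ((1 - r : ℝ) : ℂ) := by
      rw [equivariantFun_one_sub_conj, h, Complex.conj_ofReal]; push_cast; rfl
    have hs := mem_halfStrip_of_mem_leftHalf hl h'
    obtain ⟨h1, h2⟩ := one_le_of_mem_leftHalf hl h'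
    refine Or.inr ⟨by linarith, hs,
      (mem_frontier_iff_of_reflect_mem_halfStrip hτ hs).trans (h2.trans ?_)⟩
    constructor <;> intro <;> linarith

lemma existsUnique_real_value {r : ℝ} (hr : r ≤ 0 ∨ 1 ≤ r) :
    ∃! τ : ℍ, τ ∈ basicDomain ∧ equivariantFun τ = r := by
  have huniq : ∀ τ τ' : ℍ, τ ∈ basicDomain → τ' ∈ basicDomain → equivariantFun τ = r →
      equivariantFun τ' = r → τ = τ' := by
    intro τ τ' hτ hτ' h h'
    rcases real_value_on_basicDomain hτ h with ⟨h1, hs, -⟩ | ⟨h1, hs, -⟩ <;>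
    rcases real_value_on_basicDomain hτ' h' with ⟨h1', hs', -⟩ | ⟨h1', hs', -⟩
    · exact UpperHalfPlane.ext (injOn_equivariantFun hs hs' (h.trans h'.symm))
    · linarith
    · linarith
    · have := injOn_equivariantFun hs hs' (by
        rw [equivariantFun_one_sub_conj, equivariantFun_one_sub_conj, h, h'])
      exact UpperHalfPlane.ext ((starRingEnd ℂ).injective (sub_right_injective this))
  suffices ∃ τ : ℍ, τ ∈ basicDomain ∧ equivariantFun τ = r by
    obtain ⟨τ, hτ, h⟩ := this
    exact ⟨τ, ⟨hτ, h⟩, fun τ' h' => huniq τ' τ h'.1 hτ h'.2 h⟩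
  rcases hr with hr | hr
  · obtain ⟨z, hz, h⟩ := exists_mem_leftHalf (r := 1 - r) (by linarith)
    refine ⟨reflect ⟨z, hz.2.2.2⟩, reflect_mem_basicDomain (mem_basicDomain_of_mem_leftHalf hz), ?_⟩
    rw [reflect, coe_mk, coe_mk, equivariantFun_one_sub_conj, h, Complex.conj_ofReal]
    push_cast; ring
  · obtain ⟨z, hz, h⟩ := exists_mem_leftHalf hr
    exact ⟨⟨z, hz.2.2.2⟩, mem_basicDomain_of_mem_leftHalf hz, h⟩

lemma frontier_moebiusImage (γ : SL(2, ℤ)) (S : Set ℍ) :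
    frontier (moebiusImage γ S) = moebiusImage γ (frontier S) :=
  ((Homeomorph.smul (γ : GL (Fin 2) ℝ)).image_frontier S).symm

/-- In `γ(F)` the critical points correspond to the points of `F` where `h` is `-d / c`. -/
lemma isCriticalPointE6_smul_iff_eq {γ : SL(2, ℤ)} {τ : ℍ} (hτ : τ ∈ basicDomain)
    (hc : γ 1 0 ≠ 0) : IsCriticalPointE6 (γ • τ) ↔
      equivariantFun τ = ((-((γ 1 1 : ℤ) : ℝ) / ((γ 1 0 : ℤ) : ℝ) : ℝ) : ℂ) := by
  have hc' : ((γ 1 0 : ℤ) : ℂ) ≠ 0 := Int.cast_ne_zero.mpr hc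
  rw [isCriticalPointE6_smul_iff γ τ (by simpa using im_ge_of_mem_basicDomain hτ)]
  push_cast
  rw [eq_div_iff hc', eq_neg_iff_add_eq_zero, mul_comm]

lemma not_isCriticalPointE6_smul {γ : SL(2, ℤ)} {τ : ℍ} (hτ : τ ∈ basicDomain)
    (hc : γ 1 0 = 0) : ¬ IsCriticalPointE6 (γ • τ) := by
  rw [isCriticalPointE6_smul_iff γ τ (by simpa using im_ge_of_mem_basicDomain hτ), hc]
  have hdet := Matrix.det_fin_two (γ : Matrix (Fin 2) (Fin 2) ℤ)
  rw [γ.det_coe, hc, mul_zero, sub_zero] at hdet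
  simp only [Int.cast_zero, zero_mul, zero_add, Int.cast_eq_zero]
  rintro h
  rw [h, mul_zero] at hdet
  exact one_ne_zero hdet

end EisensteinSix

open EisensteinSix in
theorem theorem1p3 (γ : SL(2, ℤ)) (c d : ℤ) (hc : c = γ 1 0) (hd : d = γ 1 1) :
    -- the case where `-d / c` lies in `(0, 1) ∪ {∞}`
    ((c = 0 ∨ (c ≠ 0 ∧ (-d : ℝ) / (c : ℝ) ∈ Set.Ioo (0 : ℝ) 1)) →
      ¬ ∃ τ : ℍ, τ ∈ moebiusImage γ basicDomain ∧ IsCriticalPointE6 τ) ∧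
    -- the case where `-d / c` lies in `(-∞, 0] ∪ [1, ∞)`
    ((c ≠ 0 ∧ (-d : ℝ) / (c : ℝ) ∈ Set.Iic (0 : ℝ) ∪ Set.Ici (1 : ℝ)) →
      (∃! τ : ℍ, τ ∈ moebiusImage γ basicDomain ∧ IsCriticalPointE6 τ) ∧
      (∀ τ : ℍ, τ ∈ moebiusImage γ basicDomain → IsCriticalPointE6 τ →
        (τ ∈ frontier (moebiusImage γ basicDomain) ↔
          (-d : ℝ) / (c : ℝ) ∈ ({0, 1} : Set ℝ)))) ∧
    -- the boundary of `γ(F)` is `γ(∂F)`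
    frontier (moebiusImage γ basicDomain) = moebiusImage γ (frontier basicDomain) := by
  subst hc hd
  refine ⟨?_, ?_, frontier_moebiusImage γ _⟩
  · rintro h ⟨_, ⟨τ, hτ, rfl⟩, hcrit⟩
    rcases h with hc | ⟨hc, hr⟩
    · exact not_isCriticalPointE6_smul hτ hc hcrit
    · rcases real_value_on_basicDomain hτ ((isCriticalPointE6_smul_iff_eq hτ hc).mp hcrit) with
        ⟨h1, -⟩ | ⟨h1, -⟩
      · exact absurd hr.2 h1.not_gt
      · exact absurd hr.1 h1.not_gt
  · rintro ⟨hc, hr⟩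
    refine ⟨?_, ?_⟩
    · obtain ⟨τ, ⟨hτ, hv⟩, huniq⟩ := existsUnique_real_value hr
      refine ⟨γ • τ, ⟨⟨τ, hτ, rfl⟩, (isCriticalPointE6_smul_iff_eq hτ hc).mpr hv⟩, ?_⟩
      rintro _ ⟨⟨τ', hτ', rfl⟩, hcrit⟩
      rw [huniq τ' ⟨hτ', (isCriticalPointE6_smul_iff_eq hτ' hc).mp hcrit⟩]
    · rintro _ ⟨τ, hτ, rfl⟩ hcrit
      rw [frontier_moebiusImage, moebiusImage,
        (MulAction.injective γ).mem_set_image]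
      rcases real_value_on_basicDomain hτ ((isCriticalPointE6_smul_iff_eq hτ hc).mp hcrit) with
        ⟨h1, -, h2⟩ | ⟨h1, -, h2⟩
      · rw [h2]
        constructor
        · exact Or.inr
        · rintro (h | h)
          · linarith
          · exact h
      · rw [h2]
        constructor
        · exact Or.inl
        · rintro (h | h)
          · exact h
          · rw [Set.mem_singleton_iff] at h
            linarith
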